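/- Let $\mathbf{k}$ be a field of characteristic $0$; all algebras are commutative unital $\mathbf{k}$-algebras and tensor products are over $\mathbf{k}$. **Definitions.** A *modified differential algebra* is an algebra $R$ with a $\mathbf{k}$-linear operator $D$ such that $D(xy)=D(x)y+xD(y)-xD(1)y$ for all $x,y\in R$. Fix a modified differential algebra $(A,d)$. A *compatible complete modified differential Reynolds algebra over $(A,d)$* is an $A$-algebra $R$ with structure map $i_R:A\to R$, a decreasing filtration $(R_n)_{n\ge 0}$ of $R$ by $A$-submodules, and $\mathbf{k}$-linear operators $D,P:R\to R$, such that 1. $(R,D)$ is a modified differential algebra and $D\,i_R=i_R\,d$; 2. $P(x)P(y)=P(P(x)y)+P(xP(y))-P\big(P(x)D(1)P(y)\big)$ for all $x,y\in R$, and $DP=\mathrm{id}_R$; 3. the natural map $R\to\varprojlim R/R_n$ is bijective; 4. $R_0=R$ and, for all $n\ge 1$, $R_n$ is the closure, in the topology given by the filtration, of the $A$-submodule $A\,P(R_{n-1})$ generated by $P(R_{n-1})$; 5. $D$ and, for every $x\in R$, the multiplication $y\mapsto xy$ are continuous in this topology. Morphisms are the $A$-algebra homomorphisms $f:R\to S$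 with $fD=Df$, $fP=Pf$ and $f(R_n)\subseteq S_n$ for all $n$. On the space of tensor-power series $Ш(A)=\prod_{j\ge1}A^{\otimes j}$ put $Ш(A)_n=\prod_{j\ge n+1}A^{\otimes j}$ for $n\ge 0$, and let $j_A:A\to Ш(A)$ be the natural inclusion. Let $\lambda=d(1_A)$. For $\mathfrak a=a_1\otimes\cdots\otimes a_m$ and $\mathfrak b=b_1\otimes\cdots\otimes b_n$ with $m,n\ge1$, the *complete shuffle product* $\mathfrak a\,\hat{ш}\,\mathfrak b$ is the sum of all the tensors obtained from a shuffle $c_1\otimes\cdots\otimes c_{m+n}$ of $\mathfrak a$ and $\mathfrak b$ by inserting a tensor power $(-\lambda)^{\otimes i}$, $i\ge 0$, in front of each factor up to and including the first factor which is the letter $a_m$ or the letter $b_n$, with no insertion after that factor; also $1_{\mathbf k}\,\hat{ш}\,\mathfrak a=\mathfrak a\,\hat{ш}\,1_{\mathbf k}=\mathfrak a$ for $1_{\mathbf k}\in A^{\otimes 0}=\mathbf k$. Define, first on pure tensors and then on series by componentwise (bi)linear extension, $$(a_0\otimes\mathfrak a)\diamond(b_0\otimes\mathfrak b)=a_0b_0\otimes(\mathfrak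 a\,\hat{ш}\,\mathfrak b),\qquad P(\mathfrak a)=1_A\otimes\mathfrak a,\qquad D(a_0)=d(a_0),$$ $$D(a_0\otimes a_1\otimes\cdots\otimes a_k)=d(a_0)\otimes a_1\otimes\cdots\otimes a_k+a_0a_1\otimes a_2\otimes\cdots\otimes a_k-d(1_A)a_0\otimes a_1\otimes\cdots\otimes a_k\quad(k\ge1).$$ **Theorem.** Let $(A,d)$ be a commutative modified differential algebra. Then $\big(Ш(A),Ш(A)_n,\diamond,D,P,j_A\big)$ is a compatible complete modified differential Reynolds algebra over $(A,d)$, and it is the free (that is, initial) one: for every compatible complete modified differential Reynolds algebra $R$ over $(A,d)$ there is exactly one morphism $Ш(A)\to R$. -/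

import Mathlib

open scoped TensorProduct Topology

universe u v w w'

namespace FreeReynolds

/-! ### Modified differential and weighted Reynolds operators -/

section Operators

variable {k : Type u} {R : Type v} [CommRing k] [CommRing R] [Algebra k R]

/-- `D` makes the unital algebra `R` a modified differential algebra
(necessarily of weight `D 1`). -/
def IsModifiedDifferential (D : R →ₗ[k] R) : Prop :=
  ∀ x y : R, D (x * y) = D x * y + x * D y - x * D 1 * y

/-- `P` is a Reynolds operator of weight `l ∈ R`. -/
def IsReynolds (l : R) (P : R →ₗ[k] R) : Prop :=
  ∀ x y : R, P x * P y = P (P x * y) + P (x * P y) - P (P x * l * P y)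

end Operators

/-! ### Complete filtered modules and operator generated filtrations -/

section Filtered

variable {A : Type u} {R : Type v} [CommRing A] [AddCommGroup R] [Module A R]

/-- The topology on `R` given by a decreasing filtration: the cosets `x + R_n` form a
neighbourhood basis at `x`. -/
abbrev filtrationTopology (fil : ℕ → Submodule A R) (hfil : Antitone fil) :
    TopologicalSpace R where
  IsOpen U := ∀ x ∈ U, ∃ n, ∀ y, y - x ∈ fil n → y ∈ U
  isOpen_univ := fun _ _ => ⟨0, fun _ _ => trivial⟩
  isOpen_inter := by
    intro U V hU hV x hx
    obtain ⟨m, hm⟩ := hU x hx.1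
    obtain ⟨n, hn⟩ := hV x hx.2
    exact ⟨max m n, fun y hy => ⟨hm y (hfil (le_max_left m n) hy),
      hn y (hfil (le_max_right m n) hy)⟩⟩
  isOpen_sUnion := by
    intro S hS x hx
    obtain ⟨U, hU, hxU⟩ := hx
    obtain ⟨n, hn⟩ := hS U hU x hxU
    exact ⟨n, fun y hy => ⟨U, hU, hn y hy⟩⟩

/-- The inverse limit of the quotients `R / R_n`, as a subset of their product. -/
def inverseLimit (fil : ℕ → Submodule A R) (hfil : Antitone fil) : Set (∀ n, R ⧸ fil n) :=
  {s | ∀ m n (h : m ≤ n), Submodule.factor (hfil h) (s n) = s m}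

/-- `R` is complete: the natural map from `R` to the inverse limit of the `R / R_n` is
bijective. -/
def IsFiltrationComplete (fil : ℕ → Submodule A R) (hfil : Antitone fil) : Prop :=
  Set.BijOn (fun (x : R) (n : ℕ) => (Submodule.Quotient.mk x : R ⧸ fil n)) Set.univ
    (inverseLimit fil hfil)

/-- The closed powers of the operator `P`: the zeroth one is `R`, and the `(n+1)`-st one is the
closure of the `A`-submodule `A P(F)` generated by the image under `P` of the `n`-th one `F`. -/
def closedPowers (fil : ℕ → Submodule A R) (hfil : Antitone fil) (P : R → R) : ℕ → Set R
  | 0 => Set.univ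
  | n + 1 => @closure R (filtrationTopology fil hfil)
      (Submodule.span A (P '' closedPowers fil hfil P n) : Set R)

end Filtered

/-! ### The category of compatible complete modified differential Reynolds algebras -/

/-- A commutative compatible complete modified differential Reynolds algebra over the modified
differential algebra `(A, d)`. The structure map is `algebraMap A carrier`. As usual for complete
algebras, the product and `D` are continuous; for `P` this follows from the compatibility. -/
structure CompleteMDRA (k : Type u) {A : Type v} [Field k] [CommRing A] [Algebra k A]
    (d : A →ₗ[k] A) where
  carrier : Type w
  [commRing : CommRing carrier]
  [algebraBase : Algebra k carrier]
  [algebra : Algebra A carrier]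
  [isScalarTower : IsScalarTower k A carrier]
  /-- the filtration by `A`-submodules -/
  fil : ℕ → Submodule A carrier
  /-- the modified differential operator -/
  D : carrier →ₗ[k] carrier
  /-- the Reynolds operator -/
  P : carrier →ₗ[k] carrier
  D_modified : IsModifiedDifferential D
  D_algebraMap : ∀ a : A, D (algebraMap A carrier a) = algebraMap A carrier (d a)
  P_reynolds : IsReynolds (D 1) P
  D_P : ∀ x, D (P x) = x
  fil_antitone : Antitone fil
  complete : IsFiltrationComplete fil fil_antitone
  /-- compatibility: the filtration is generated by the operator -/
  compatible : ∀ n, (fil n : Set carrier) = closedPowers fil fil_antitone P n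
  /-- multiplication by each element is continuous for the filtration topology -/
  continuous_mul_left : ∀ x : carrier,
    Continuous[filtrationTopology fil fil_antitone, filtrationTopology fil fil_antitone]
      (fun y => x * y)
  /-- `D` is continuous for the filtration topology -/
  continuous_D :
    Continuous[filtrationTopology fil fil_antitone, filtrationTopology fil fil_antitone] D

attribute [instance] CompleteMDRA.commRing CompleteMDRA.algebraBase CompleteMDRA.algebra
  CompleteMDRA.isScalarTower

/-- A homomorphism: an `A`-algebra homomorphism (in particular it commutes with the structure
maps) that commutes with the operators and preserves the filtrations. -/
structure CompleteMDRA.IsHom {k : Type u} {A : Type v} [Field k] [CommRing A] [Algebra k A]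
    {d : A →ₗ[k] A} (R : CompleteMDRA.{u, v, w} k d) (S : CompleteMDRA.{u, v, w'} k d)
    (f : R.carrier →ₐ[A] S.carrier) : Prop where
  map_D : ∀ x, f (R.D x) = S.D (f x)
  map_P : ∀ x, f (R.P x) = S.P (f x)
  map_fil : ∀ n, ∀ x ∈ R.fil n, f x ∈ S.fil n

/-! ### Tensor-power series -/

section Sha

variable (k : Type u) {A : Type v} [Field k] [CommRing A] [Algebra k A]

/-- The identification `A ⊗ A^{⊗ n} ≃ A^{⊗ (n+1)}`, `a ⊗ (a₁ ⊗ ⋯ ⊗ aₙ) ↦ a ⊗ a₁ ⊗ ⋯ ⊗ aₙ`. -/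
noncomputable def consEquiv (n : ℕ) : A ⊗[k] (⨂[k]^n A) ≃ₗ[k] ⨂[k]^(n + 1) A :=
  (TensorProduct.congr (PiTensorProduct.subsingletonEquiv (R := k) (s := fun _ : Fin 1 => A)
      (0 : Fin 1)).symm (LinearEquiv.refl k _)) ≪≫ₗ
    TensorPower.mulEquiv ≪≫ₗ TensorPower.cast k A (add_comm 1 n)

theorem consEquiv_tmul_tprod (n : ℕ) (a : A) (v : Fin n → A) :
    consEquiv k n (a ⊗ₜ PiTensorProduct.tprod k v) =
      PiTensorProduct.tprod k (Fin.cons a v : Fin (n + 1) → A) := by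
  have h : (PiTensorProduct.subsingletonEquiv (R := k) (s := fun _ : Fin 1 => A)
      (0 : Fin 1)).symm a = PiTensorProduct.tprod k (fun _ => a) := by
    rw [LinearEquiv.symm_apply_eq, PiTensorProduct.subsingletonEquiv_apply_tprod]
  simp only [consEquiv, LinearEquiv.trans_apply, TensorProduct.congr_tmul, h,
    LinearEquiv.refl_apply]
  erw [← TensorPower.gMul_def, TensorPower.tprod_mul_tprod, TensorPower.cast_tprod]
  congr 1
  ext i
  refine Fin.cases ?_ (fun j => ?_) i
  · simp [Fin.append, Fin.addCases]
  · have hj : ∀ hle, Fin.subNat 1 j.succ hle = j := fun _ => Fin.ext (by simp)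
    simp [Fin.append, Fin.addCases, hj]

/-- The positions of the letters of an extended shuffle of `a₁ ⊗ ⋯ ⊗ aₘ` and `b₁ ⊗ ⋯ ⊗ bₙ` in a
word of length `r`: the `aᵢ` occur in their order, so do the `bⱼ`, and every other position
(which will carry an inserted letter) comes before some `aᵢ` and before some `bⱼ`, that is,
before the first occurrence of one of `aₘ` and `bₙ`. -/
def IsExtendedShuffle {m n r : ℕ} (e : Fin m ⊕ Fin n ↪ Fin r) : Prop :=
  StrictMono (fun i => e (Sum.inl i)) ∧ StrictMono (fun j => e (Sum.inr j)) ∧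
    ∀ p, p ∉ Set.range e → (∃ i, p < e (Sum.inl i)) ∧ (∃ j, p < e (Sum.inr j))

theorem extend_update {ι κ B : Type*} [DecidableEq ι] [DecidableEq κ] (e : ι ↪ κ) (c : ι → B)
    (i : ι) (x : B) (g : κ → B) :
    Function.extend e (Function.update c i x) g =
      Function.update (Function.extend e c g) (e i) x := by
  funext p
  by_cases hp : ∃ j, e j = p
  · obtain ⟨j, rfl⟩ := hp
    by_cases hj : j = i
    · subst hj
      simp [e.injective.extend_apply]
    · rw [e.injective.extend_apply, Function.update_of_ne hj,
        Function.update_of_ne (fun h => hj (e.injective h)), e.injective.extend_apply]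
  · have hpi : p ≠ e i := fun h => hp ⟨i, h.symm⟩
    rw [Function.extend_apply' _ _ _ hp, Function.update_of_ne hpi,
      Function.extend_apply' _ _ _ hp]

/-- The word of length `r` with the letters `c` at the positions `e` and with the letter `-l` at
all the other positions, as a multilinear function of `c`. -/
noncomputable def extendedWord (l : A) {m n r : ℕ} (e : Fin m ⊕ Fin n ↪ Fin r) :
    MultilinearMap k (fun _ : Fin m ⊕ Fin n => A) (⨂[k]^r A) where
  toFun c := PiTensorProduct.tprod k (Function.extend e c (fun _ => -l))
  map_update_add' c i x y := by
    simp only [extend_update, MultilinearMap.map_update_add]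
  map_update_smul' c i t x := by
    simp only [extend_update, MultilinearMap.map_update_smul]

open Classical in
/-- The component in `A^{⊗ r}` of the complete shuffle product `A^{⊗ m} × A^{⊗ n} → ∏_r A^{⊗ r}`
of weight `l`: the sum of all the extended shuffles of length `r`. -/
noncomputable def completeShuffle (l : A) (m n r : ℕ) :
    (⨂[k]^m A) →ₗ[k] (⨂[k]^n A) →ₗ[k] (⨂[k]^r A) :=
  TensorProduct.curry
    ((∑ e : {e : Fin m ⊕ Fin n ↪ Fin r // IsExtendedShuffle e},
        PiTensorProduct.lift (extendedWord k l e.1)) ∘ₗ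
      (PiTensorProduct.tmulEquiv k A).toLinearMap)

variable (A) in
/-- The space `∏_{j ≥ 1} A^{⊗ j}` of tensor-power series; the coordinate of index `n` is the one
in `A^{⊗ (n+1)}`. -/
abbrev Sha : Type (max u v) := ∀ n : ℕ, ⨂[k]^(n + 1) A

namespace Sha

/-- The product `(a₀ ⊗ 𝔞) ⋄ (b₀ ⊗ 𝔟) = a₀ b₀ ⊗ (𝔞 ⧢ 𝔟)`, with the complete shuffle product of
weight `l` of the tails, extended to series; only tails of lengths `m, n ≤ r` contribute to the
terms whose tail has length `r`. -/
noncomputable def mul (l : A) (x y : Sha k A) : Sha k A := fun r =>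
  ∑ m ∈ Finset.range (r + 1), ∑ n ∈ Finset.range (r + 1),
    consEquiv k r (TensorProduct.map₂ (LinearMap.mul k A) (completeShuffle k l m n r)
      ((consEquiv k m).symm (x m)) ((consEquiv k n).symm (y n)))

/-- The natural inclusion of `A` as the space of tensors of length one. -/
noncomputable def of (a : A) : Sha k A :=
  Pi.single 0 (PiTensorProduct.tprod k (fun _ => a))

/-- The filtration by tensor length: the `n`-th term is `∏_{j ≥ n+1} A^{⊗ j}`. -/
def fil (n : ℕ) : Set (Sha k A) := {x | ∀ i < n, x i = 0}

/-- The operator `P(𝔞) = 1 ⊗ 𝔞`. -/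
noncomputable def P (x : Sha k A) : Sha k A
  | 0 => 0
  | n + 1 => consEquiv k (n + 1) (1 ⊗ₜ[k] x n)

/-- Applying a linear operator to the left-most tensor factor. -/
noncomputable def onHead (g : A →ₗ[k] A) (n : ℕ) : (⨂[k]^(n + 1) A) →ₗ[k] (⨂[k]^(n + 1) A) :=
  (consEquiv k n).toLinearMap ∘ₗ TensorProduct.map g LinearMap.id ∘ₗ
    (consEquiv k n).symm.toLinearMap

/-- Multiplying the two left-most factors: `a₀ ⊗ a₁ ⊗ 𝔞 ↦ a₀ a₁ ⊗ 𝔞`. -/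
noncomputable def mergeHead (n : ℕ) : (⨂[k]^(n + 2) A) →ₗ[k] (⨂[k]^(n + 1) A) :=
  (consEquiv k n).toLinearMap ∘ₗ TensorProduct.map (LinearMap.mul' k A) LinearMap.id ∘ₗ
    (TensorProduct.assoc k A A (⨂[k]^n A)).symm.toLinearMap ∘ₗ
    TensorProduct.map LinearMap.id (consEquiv k n).symm.toLinearMap ∘ₗ
    (consEquiv k (n + 1)).symm.toLinearMap

/-- The operator `D` with `D(a₀) = d(a₀)` and
`D(a₀ ⊗ a₁ ⊗ 𝔞) = d(a₀) ⊗ a₁ ⊗ 𝔞 + a₀ a₁ ⊗ 𝔞 - d(1) a₀ ⊗ a₁ ⊗ 𝔞`, extended to series. -/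
noncomputable def D (d : A →ₗ[k] A) (x : Sha k A) : Sha k A
  | 0 => onHead k d 0 (x 0) + mergeHead k 0 (x 1)
  | n + 1 => onHead k d (n + 1) (x (n + 1)) + mergeHead k (n + 1) (x (n + 2))
      - onHead k (LinearMap.mulLeft k (d 1)) (n + 1) (x (n + 1))

end Sha

end Sha

end FreeReynolds

/-!
The series algebra is free because every series is a limit of `A`-linear combinations of `1` and
of values of `P`, and because the defining data are determined on these by the identities of a
modified differential Reynolds algebra.

Sorting the extended shuffles of two nonempty words by the letter in the first position gives a
recursion for the complete shuffle product (`completeShuffle_succ`). In terms of series it is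
exactly the Reynolds identity `P x * P y = P (P x * y + x * P y - l * P x * P y)`
(`Series.mulHom_P_P`), and this is all that is needed about shuffles apart from unit, symmetry
and degree.

Each remaining identity is the vanishing of a defect that is `A`-linear in every variable: the
associator, the failure of the modified Leibniz rule for `D`, the failure of a map to be
multiplicative or to commute with `D`. By the density principle (`Series.mem_of_isLinearMap`) such
a defect lies in a given term of the filtration as soon as its values at `1` and on the image of
`P` do. At `1` it vanishes. On the image of `P` it either vanishes because `D P = id`, or the
Reynolds identity writes it as `P` of a combination of defects (`Series.assocDefect_P_P_P`,
`CompleteMDRA.mulDefect_P_P`). As `P` raises the filtration degree by one, induction puts the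
defect into every term of the filtration, so it is zero.

The homomorphism to a complete algebra `R` sends `a₀ ⊗ a₁ ⊗ ⋯ ⊗ aₙ` to `a₀ P(a₁ P(a₂ ⋯ P(aₙ)))`
and a series to the limit of the values of its truncations (`CompleteMDRA.eval`). The difference of
two homomorphisms commutes with `P`, so the same induction shows that it vanishes.
-/

namespace FreeReynolds

/-! ### The recursion of the complete shuffle product -/

section Shuffle

/-- Shift an arrangement of the letters of two words by one position, and put a new first letter of
the left word at the position `0`. -/
def consLeft {m n r : ℕ} (e : Fin m ⊕ Fin n ↪ Fin r) : Fin (m + 1) ⊕ Fin n ↪ Fin (r + 1) where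
  toFun := Sum.elim (Fin.cases 0 fun i => (e (Sum.inl i)).succ) fun j => (e (Sum.inr j)).succ
  inj' := by
    rintro (i | i) (j | j) h
    · refine Fin.cases ?_ (fun i => ?_) i h <;> refine Fin.cases ?_ (fun j => ?_) j <;>
        simp [Fin.succ_ne_zero, (Fin.succ_ne_zero _).symm]
    · refine Fin.cases ?_ (fun i => ?_) i h <;> simp [(Fin.succ_ne_zero _).symm]
    · refine Fin.cases ?_ (fun j => ?_) j h <;> simp [Fin.succ_ne_zero]
    · simpa using h

/-- Shift an arrangement of the letters of two words by one position, and put a new first letter of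
the right word at the position `0`. -/
def consRight {m n r : ℕ} (e : Fin m ⊕ Fin n ↪ Fin r) : Fin m ⊕ Fin (n + 1) ↪ Fin (r + 1) where
  toFun := Sum.elim (fun i => (e (Sum.inl i)).succ) (Fin.cases 0 fun j => (e (Sum.inr j)).succ)
  inj' := by
    rintro (i | i) (j | j) h
    · simpa using h
    · refine Fin.cases ?_ (fun j => ?_) j h <;> simp [Fin.succ_ne_zero]
    · refine Fin.cases ?_ (fun i => ?_) i h <;> simp [(Fin.succ_ne_zero _).symm]
    · refine Fin.cases ?_ (fun i => ?_) i h <;> refine Fin.cases ?_ (fun j => ?_) j <;>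
        simp [Fin.succ_ne_zero, (Fin.succ_ne_zero _).symm]

variable {m n r : ℕ}

@[simp] theorem consLeft_inl_zero (e : Fin m ⊕ Fin n ↪ Fin r) :
    consLeft e (Sum.inl 0) = 0 := rfl

@[simp] theorem consLeft_inl_succ (e : Fin m ⊕ Fin n ↪ Fin r) (i : Fin m) :
    consLeft e (Sum.inl i.succ) = (e (Sum.inl i)).succ := rfl

@[simp] theorem consLeft_inr (e : Fin m ⊕ Fin n ↪ Fin r) (j : Fin n) :
    consLeft e (Sum.inr j) = (e (Sum.inr j)).succ := rfl

@[simp] theorem consRight_inl (e : Fin m ⊕ Fin n ↪ Fin r) (i : Fin m) :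
    consRight e (Sum.inl i) = (e (Sum.inl i)).succ := rfl

@[simp] theorem consRight_inr_zero (e : Fin m ⊕ Fin n ↪ Fin r) :
    consRight e (Sum.inr 0) = 0 := rfl

@[simp] theorem consRight_inr_succ (e : Fin m ⊕ Fin n ↪ Fin r) (j : Fin n) :
    consRight e (Sum.inr j.succ) = (e (Sum.inr j)).succ := rfl

theorem isExtendedShuffle_consLeft_iff {e : Fin m ⊕ Fin (n + 1) ↪ Fin r} :
    IsExtendedShuffle (consLeft e) ↔ IsExtendedShuffle e := by
  constructor
  · rintro ⟨h1, h2, h3⟩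
    refine ⟨fun i j hij => ?_, fun i j hij => ?_, fun p hp => ?_⟩
    · simpa using h1 (Fin.succ_lt_succ_iff.2 hij)
    · simpa using h2 hij
    · have hp' : p.succ ∉ Set.range (consLeft e) := by
        rintro ⟨i | i, hi⟩
        · revert hi
          refine Fin.cases (fun hi => ?_) (fun i hi => ?_) i
          · exact Fin.succ_ne_zero p hi.symm
          · exact hp ⟨Sum.inl i, by simpa using hi⟩
        · exact hp ⟨Sum.inr i, by simpa using hi⟩
      obtain ⟨⟨i, hi⟩, ⟨j, hj⟩⟩ := h3 _ hp'
      refine ⟨?_, j, by simpa using hj⟩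
      revert hi
      refine Fin.cases (fun hi => ?_) (fun i hi => ⟨i, by simpa using hi⟩) i
      simp at hi
  · rintro ⟨h1, h2, h3⟩
    refine ⟨fun i j => ?_, fun i j hij => ?_, fun p => ?_⟩
    · refine Fin.cases ?_ (fun i => ?_) i <;> refine Fin.cases ?_ (fun j => ?_) j
      · simp
      · simp
      · simp
      · intro hij
        simpa using h1 (Fin.succ_lt_succ_iff.1 hij)
    · simpa using h2 hij
    · refine Fin.cases (fun hp => (hp ⟨Sum.inl 0, rfl⟩).elim) (fun p hp => ?_) p
      have hp' : p ∉ Set.range e := by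
        rintro ⟨i | i, hi⟩
        · exact hp ⟨Sum.inl i.succ, by simp [hi]⟩
        · exact hp ⟨Sum.inr i, by simp [hi]⟩
      obtain ⟨⟨i, hi⟩, ⟨j, hj⟩⟩ := h3 _ hp'
      exact ⟨⟨i.succ, by simpa using hi⟩, ⟨j, by simpa using hj⟩⟩

theorem isExtendedShuffle_consRight_iff {e : Fin (m + 1) ⊕ Fin n ↪ Fin r} :
    IsExtendedShuffle (consRight e) ↔ IsExtendedShuffle e := by
  constructor
  · rintro ⟨h1, h2, h3⟩
    refine ⟨fun i j hij => ?_, fun i j hij => ?_, fun p hp => ?_⟩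
    · simpa using h1 hij
    · simpa using h2 (Fin.succ_lt_succ_iff.2 hij)
    · have hp' : p.succ ∉ Set.range (consRight e) := by
        rintro ⟨i | i, hi⟩
        · exact hp ⟨Sum.inl i, by simpa using hi⟩
        · revert hi
          refine Fin.cases (fun hi => ?_) (fun i hi => ?_) i
          · exact Fin.succ_ne_zero p hi.symm
          · exact hp ⟨Sum.inr i, by simpa using hi⟩
      obtain ⟨⟨i, hi⟩, ⟨j, hj⟩⟩ := h3 _ hp'
      refine ⟨⟨i, by simpa using hi⟩, ?_⟩
      revert hj
      refine Fin.cases (fun hj => ?_) (fun j hj => ⟨j, by simpa using hj⟩) j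
      simp at hj
  · rintro ⟨h1, h2, h3⟩
    refine ⟨fun i j hij => ?_, fun i j => ?_, fun p => ?_⟩
    · simpa using h1 hij
    · refine Fin.cases ?_ (fun i => ?_) i <;> refine Fin.cases ?_ (fun j => ?_) j
      · simp
      · simp
      · simp
      · intro hij
        simpa using h2 (Fin.succ_lt_succ_iff.1 hij)
    · refine Fin.cases (fun hp => (hp ⟨Sum.inr 0, rfl⟩).elim) (fun p hp => ?_) p
      have hp' : p ∉ Set.range e := by
        rintro ⟨i | i, hi⟩
        · exact hp ⟨Sum.inl i, by simp [hi]⟩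
        · exact hp ⟨Sum.inr i.succ, by simp [hi]⟩
      obtain ⟨⟨i, hi⟩, ⟨j, hj⟩⟩ := h3 _ hp'
      exact ⟨⟨i, by simpa using hi⟩, ⟨j.succ, by simpa using hj⟩⟩

theorem isExtendedShuffle_trans_succ_iff {e : Fin (m + 1) ⊕ Fin (n + 1) ↪ Fin r} :
    IsExtendedShuffle (e.trans (Fin.succEmb r)) ↔ IsExtendedShuffle e := by
  constructor
  · rintro ⟨h1, h2, h3⟩
    refine ⟨fun i j hij => ?_, fun i j hij => ?_, fun p hp => ?_⟩
    · simpa using h1 hij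
    · simpa using h2 hij
    · have hp' : p.succ ∉ Set.range (e.trans (Fin.succEmb r)) := by
        rintro ⟨i, hi⟩
        exact hp ⟨i, by simpa using hi⟩
      simpa using h3 _ hp'
  · rintro ⟨h1, h2, h3⟩
    refine ⟨fun i j hij => ?_, fun i j hij => ?_, fun p => ?_⟩
    · simpa using h1 hij
    · simpa using h2 hij
    · refine Fin.cases (fun _ => ⟨⟨0, by simp⟩, ⟨0, by simp⟩⟩) (fun p hp => ?_) p
      have hp' : p ∉ Set.range e := by
        rintro ⟨i, hi⟩
        exact hp ⟨i, by simp [hi]⟩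
      simpa using h3 _ hp'

/-- The extended shuffles of two nonempty words, sorted by the letter in the first position. -/
def extendedShuffleSucc :
    {e : Fin m ⊕ Fin (n + 1) ↪ Fin r // IsExtendedShuffle e} ⊕
      {e : Fin (m + 1) ⊕ Fin n ↪ Fin r // IsExtendedShuffle e} ⊕
      {e : Fin (m + 1) ⊕ Fin (n + 1) ↪ Fin r // IsExtendedShuffle e} →
    {e : Fin (m + 1) ⊕ Fin (n + 1) ↪ Fin (r + 1) // IsExtendedShuffle e} :=
  Sum.elim (fun e => ⟨consLeft e.1, isExtendedShuffle_consLeft_iff.2 e.2⟩)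
    (Sum.elim (fun e => ⟨consRight e.1, isExtendedShuffle_consRight_iff.2 e.2⟩)
      (fun e => ⟨e.1.trans (Fin.succEmb r), isExtendedShuffle_trans_succ_iff.2 e.2⟩))

theorem extendedShuffleSucc_injective :
    Function.Injective (extendedShuffleSucc (m := m) (n := n) (r := r)) := by
  -- the images of the three summands differ in the values at the first letters
  rintro (⟨e, he⟩ | ⟨e, he⟩ | ⟨e, he⟩) (⟨f, hf⟩ | ⟨f, hf⟩ | ⟨f, hf⟩) h <;>
    replace h := DFunLike.congr_fun (Subtype.ext_iff.1 h)
  · congr 2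
    ext (i | i)
    · simpa [extendedShuffleSucc, Fin.ext_iff] using h (Sum.inl i.succ)
    · simpa [extendedShuffleSucc, Fin.ext_iff] using h (Sum.inr i)
  · simpa [extendedShuffleSucc, (Fin.succ_ne_zero _).symm] using h (Sum.inl 0)
  · simpa [extendedShuffleSucc, (Fin.succ_ne_zero _).symm] using h (Sum.inl 0)
  · simpa [extendedShuffleSucc, Fin.succ_ne_zero] using h (Sum.inl 0)
  · congr 3
    ext (i | i)
    · simpa [extendedShuffleSucc, Fin.ext_iff] using h (Sum.inl i)
    · simpa [extendedShuffleSucc, Fin.ext_iff] using h (Sum.inr i.succ)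
  · simpa [extendedShuffleSucc, (Fin.succ_ne_zero _).symm] using h (Sum.inr 0)
  · simpa [extendedShuffleSucc, Fin.succ_ne_zero] using h (Sum.inl 0)
  · simpa [extendedShuffleSucc, Fin.succ_ne_zero] using h (Sum.inr 0)
  · congr 3
    ext i
    simpa [extendedShuffleSucc, Fin.ext_iff] using h i

theorem extendedShuffleSucc_surjective :
    Function.Surjective (extendedShuffleSucc (m := m) (n := n) (r := r)) := by
  rintro ⟨e, he⟩
  by_cases hl : e (Sum.inl 0) = 0
  · have hi : ∀ i : Fin m, e (Sum.inl i.succ) ≠ 0 := fun i h => by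
      simpa [Fin.succ_ne_zero] using e.injective (h.trans hl.symm)
    have hj : ∀ j, e (Sum.inr j) ≠ 0 := fun j h => by
      simpa using e.injective (h.trans hl.symm)
    let f : Fin m ⊕ Fin (n + 1) ↪ Fin r :=
      ⟨Sum.elim (fun i => (e (Sum.inl i.succ)).pred (hi i)) fun j => (e (Sum.inr j)).pred (hj j), by
        rintro (i | i) (j | j) h <;> simp at h ⊢ <;> exact h⟩
    have hf : consLeft f = e := by
      refine DFunLike.ext _ _ ?_
      rintro (i | i)
      · exact Fin.cases hl.symm (fun i => Fin.succ_pred _ (hi i)) i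
      · exact Fin.succ_pred _ (hj i)
    exact ⟨Sum.inl ⟨f, isExtendedShuffle_consLeft_iff.1 (hf ▸ he)⟩, Subtype.ext hf⟩
  by_cases hr : e (Sum.inr 0) = 0
  · have hi : ∀ i : Fin n, e (Sum.inr i.succ) ≠ 0 := fun i h => by
      simpa [Fin.succ_ne_zero] using e.injective (h.trans hr.symm)
    have hj : ∀ j, e (Sum.inl j) ≠ 0 := fun j h => by
      simpa using e.injective (h.trans hr.symm)
    let f : Fin (m + 1) ⊕ Fin n ↪ Fin r :=
      ⟨Sum.elim (fun j => (e (Sum.inl j)).pred (hj j)) (fun i => (e (Sum.inr i.succ)).pred (hi i)), by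
        rintro (i | i) (j | j) h <;> simp at h ⊢ <;> exact h⟩
    have hf : consRight f = e := by
      refine DFunLike.ext _ _ ?_
      rintro (i | i)
      · exact Fin.succ_pred _ (hj i)
      · exact Fin.cases hr.symm (fun i => Fin.succ_pred _ (hi i)) i
    exact ⟨Sum.inr (Sum.inl ⟨f, isExtendedShuffle_consRight_iff.1 (hf ▸ he)⟩), Subtype.ext hf⟩
  · have hx : ∀ x, e x ≠ 0 := by
      rintro (i | i) h
      · exact hl (Fin.le_zero_iff.1 (h ▸ he.1.monotone (Fin.zero_le i)))
      · exact hr (Fin.le_zero_iff.1 (h ▸ he.2.1.monotone (Fin.zero_le i)))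
    let f : Fin (m + 1) ⊕ Fin (n + 1) ↪ Fin r :=
      ⟨fun x => (e x).pred (hx x), fun x y h => by simpa using h⟩
    have hf : f.trans (Fin.succEmb r) = e :=
      DFunLike.ext _ _ fun x => Fin.succ_pred _ (hx x)
    exact ⟨Sum.inr (Sum.inr ⟨f, isExtendedShuffle_trans_succ_iff.1 (hf ▸ he)⟩), Subtype.ext hf⟩

theorem extend_consLeft {B : Type*} (e : Fin m ⊕ Fin n ↪ Fin r) (a : B) (u : Fin m → B)
    (w : Fin n → B) (g : B) :
    Function.extend (consLeft e) (Sum.elim (Fin.cons a u : Fin (m + 1) → B) w) (fun _ => g) =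
      (Fin.cons a (Function.extend e (Sum.elim u w) fun _ => g) : Fin (r + 1) → B) := by
  funext p
  refine Fin.cases ?_ (fun p => ?_) p
  · exact (consLeft e).injective.extend_apply _ _ (Sum.inl 0)
  · rw [Fin.cons_succ]
    by_cases hp : ∃ x, e x = p
    · obtain ⟨i | i, rfl⟩ := hp
      · rw [e.injective.extend_apply]
        exact (consLeft e).injective.extend_apply _ _ (Sum.inl i.succ)
      · rw [e.injective.extend_apply]
        exact (consLeft e).injective.extend_apply _ _ (Sum.inr i)
    · rw [Function.extend_apply' _ _ _ hp, Function.extend_apply']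
      rintro ⟨i | i, hi⟩
      · revert hi
        refine Fin.cases (fun hi => Fin.succ_ne_zero p hi.symm) (fun i hi => ?_) i
        exact hp ⟨Sum.inl i, by simpa using hi⟩
      · exact hp ⟨Sum.inr i, by simpa using hi⟩

theorem extend_consRight {B : Type*} (e : Fin m ⊕ Fin n ↪ Fin r) (a : B) (u : Fin m → B)
    (w : Fin n → B) (g : B) :
    Function.extend (consRight e) (Sum.elim u (Fin.cons a w : Fin (n + 1) → B)) (fun _ => g) =
      (Fin.cons a (Function.extend e (Sum.elim u w) fun _ => g) : Fin (r + 1) → B) := by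
  funext p
  refine Fin.cases ?_ (fun p => ?_) p
  · exact (consRight e).injective.extend_apply _ _ (Sum.inr 0)
  · rw [Fin.cons_succ]
    by_cases hp : ∃ x, e x = p
    · obtain ⟨i | i, rfl⟩ := hp
      · rw [e.injective.extend_apply]
        exact (consRight e).injective.extend_apply _ _ (Sum.inl i)
      · rw [e.injective.extend_apply]
        exact (consRight e).injective.extend_apply _ _ (Sum.inr i.succ)
    · rw [Function.extend_apply' _ _ _ hp, Function.extend_apply']
      rintro ⟨i | i, hi⟩
      · exact hp ⟨Sum.inl i, by simpa using hi⟩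
      · revert hi
        refine Fin.cases (fun hi => Fin.succ_ne_zero p hi.symm) (fun i hi => ?_) i
        exact hp ⟨Sum.inr i, by simpa using hi⟩

theorem extend_trans_succ {ι B : Type*} (e : ι ↪ Fin r) (c : ι → B) (g : B) :
    Function.extend (e.trans (Fin.succEmb r)) c (fun _ => g) =
      (Fin.cons g (Function.extend e c fun _ => g) : Fin (r + 1) → B) := by
  funext p
  refine Fin.cases ?_ (fun p => ?_) p
  · rw [Function.extend_apply', Fin.cons_zero]
    rintro ⟨x, hx⟩
    exact Fin.succ_ne_zero _ hx
  · rw [Fin.cons_succ]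
    by_cases hp : ∃ x, e x = p
    · obtain ⟨x, rfl⟩ := hp
      rw [e.injective.extend_apply]
      exact (e.trans (Fin.succEmb r)).injective.extend_apply _ _ x
    · rw [Function.extend_apply' _ _ _ hp, Function.extend_apply']
      rintro ⟨x, hx⟩
      exact hp ⟨x, by simpa using hx⟩

variable (k : Type u) {A : Type v} [Field k] [CommRing A] [Algebra k A]

open Classical in
theorem completeShuffle_tprod (l : A) (a : Fin m → A) (b : Fin n → A) :
    completeShuffle k l m n r (PiTensorProduct.tprod k a) (PiTensorProduct.tprod k b) =
      ∑ e : {e : Fin m ⊕ Fin n ↪ Fin r // IsExtendedShuffle e},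
        PiTensorProduct.tprod k (Function.extend e.1 (Sum.elim a b) fun _ => -l) := by
  simp only [completeShuffle, TensorProduct.curry_apply, LinearMap.comp_apply,
    LinearEquiv.coe_coe, LinearMap.sum_apply]
  refine Finset.sum_congr rfl fun e _ => ?_
  erw [PiTensorProduct.tmulEquiv_apply, PiTensorProduct.lift.tprod]
  rfl

theorem completeShuffle_succ_tprod (l a b : A) (u : Fin m → A) (w : Fin n → A) :
    completeShuffle k l (m + 1) (n + 1) (r + 1)
        (PiTensorProduct.tprod k (Fin.cons a u : Fin (m + 1) → A))
        (PiTensorProduct.tprod k (Fin.cons b w : Fin (n + 1) → A)) =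
      consEquiv k r (a ⊗ₜ completeShuffle k l m (n + 1) r (PiTensorProduct.tprod k u)
        (PiTensorProduct.tprod k (Fin.cons b w : Fin (n + 1) → A))) +
      consEquiv k r (b ⊗ₜ completeShuffle k l (m + 1) n r
        (PiTensorProduct.tprod k (Fin.cons a u : Fin (m + 1) → A)) (PiTensorProduct.tprod k w)) -
      consEquiv k r (l ⊗ₜ completeShuffle k l (m + 1) (n + 1) r
        (PiTensorProduct.tprod k (Fin.cons a u : Fin (m + 1) → A))
        (PiTensorProduct.tprod k (Fin.cons b w : Fin (n + 1) → A))) := by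
  classical
  rw [sub_eq_add_neg, ← map_neg, ← TensorProduct.neg_tmul]
  simp only [completeShuffle_tprod, TensorProduct.tmul_sum, map_sum, consEquiv_tmul_tprod]
  rw [← Function.Bijective.sum_comp (e := extendedShuffleSucc (m := m) (n := n) (r := r))
    ⟨extendedShuffleSucc_injective, extendedShuffleSucc_surjective⟩, Fintype.sum_sum_type,
    Fintype.sum_sum_type, add_assoc]
  refine congrArg₂ _ ?_ (congrArg₂ _ ?_ ?_)
  · exact Finset.sum_congr rfl fun e _ => congrArg _ (extend_consLeft e.1 a u _ (-l))
  · exact Finset.sum_congr rfl fun e _ => congrArg _ (extend_consRight e.1 b _ w (-l))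
  · exact Finset.sum_congr rfl fun e _ => congrArg _ (extend_trans_succ e.1 _ (-l))

/-- The recursion of the complete shuffle product: the first letter of an extended shuffle of two
nonempty words is the first letter of one of the words or an inserted `-l`. -/
theorem completeShuffle_succ (l a b : A) (u : ⨂[k]^m A) (w : ⨂[k]^n A) :
    completeShuffle k l (m + 1) (n + 1) (r + 1)
        (consEquiv k m (a ⊗ₜ u)) (consEquiv k n (b ⊗ₜ w)) =
      consEquiv k r (a ⊗ₜ completeShuffle k l m (n + 1) r u (consEquiv k n (b ⊗ₜ w))) +
      consEquiv k r (b ⊗ₜ completeShuffle k l (m + 1) n r (consEquiv k m (a ⊗ₜ u)) w) -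
      consEquiv k r (l ⊗ₜ completeShuffle k l (m + 1) (n + 1) r
        (consEquiv k m (a ⊗ₜ u)) (consEquiv k n (b ⊗ₜ w))) := by
  induction u using PiTensorProduct.induction_on with
  | add u u' hu hu' =>
    simp only [map_add, TensorProduct.tmul_add, LinearMap.add_apply, hu, hu']
    abel
  | smul_tprod s u =>
    induction w using PiTensorProduct.induction_on with
    | add w w' hw hw' =>
      simp only [map_add, TensorProduct.tmul_add, hw, hw']
      abel
    | smul_tprod t w =>
      have h := completeShuffle_succ_tprod k (r := r) l a b u w
      simp only [TensorProduct.tmul_smul, map_smul, LinearMap.smul_apply, consEquiv_tmul_tprod]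
      rw [h]
      simp only [smul_sub, smul_add]

theorem completeShuffle_eq_zero (l : A) (h : r < m ∨ r < n) :
    completeShuffle k l m n r = 0 := by
  have : IsEmpty {e : Fin m ⊕ Fin n ↪ Fin r // IsExtendedShuffle e} := by
    refine ⟨fun e => ?_⟩
    have h1 : m ≤ r := by
      simpa using Fintype.card_le_of_embedding (Function.Embedding.inl.trans e.1)
    have h2 : n ≤ r := by
      simpa using Fintype.card_le_of_embedding (Function.Embedding.inr.trans e.1)
    omega
  classical
  refine PiTensorProduct.ext (MultilinearMap.ext fun a => PiTensorProduct.ext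
    (MultilinearMap.ext fun b => ?_))
  simp only [LinearMap.compMultilinearMap_apply]
  rw [completeShuffle_tprod, Fintype.sum_empty]
  rfl

theorem completeShuffle_zero_left (l : A) (u : Fin 0 → A) (w : ⨂[k]^n A) :
    completeShuffle k l 0 n n (PiTensorProduct.tprod k u) w = w := by
  classical
  suffices h : completeShuffle k l 0 n n (PiTensorProduct.tprod k u) = LinearMap.id from
    LinearMap.congr_fun h w
  refine PiTensorProduct.ext (MultilinearMap.ext fun b => ?_)
  simp only [LinearMap.compMultilinearMap_apply, LinearMap.id_apply]
  have hid : ∀ e : {e : Fin 0 ⊕ Fin n ↪ Fin n // IsExtendedShuffle e},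
      (fun j => e.1 (Sum.inr j)) = id := fun e =>
    (StrictMono.range_inj e.2.2.1 strictMono_id).1 (by
      rw [Set.range_id]
      exact (Finite.surjective_of_injective
        (e.1.injective.comp Sum.inr_injective)).range_eq)
  let e₀ : {e : Fin 0 ⊕ Fin n ↪ Fin n // IsExtendedShuffle e} :=
    ⟨(Equiv.emptySum (Fin 0) (Fin n)).toEmbedding, fun i => i.elim0, fun i j h => h,
      fun p hp => (hp ⟨Sum.inr p, rfl⟩).elim⟩
  rw [completeShuffle_tprod, Fintype.sum_eq_single e₀]
  · congr 1
    funext p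
    exact e₀.1.injective.extend_apply _ _ (Sum.inr p)
  · refine fun e he => (he (Subtype.ext (DFunLike.ext _ _ ?_))).elim
    rintro (i | i)
    · exact i.elim0
    · exact congrFun (hid e) i

theorem completeShuffle_zero_left_of_ne (l : A) (h : n ≠ r) : completeShuffle k l 0 n r = 0 := by
  have : IsEmpty {e : Fin 0 ⊕ Fin n ↪ Fin r // IsExtendedShuffle e} := by
    refine ⟨fun e => h ?_⟩
    have hs : Function.Surjective e.1 := fun p => by
      by_contra hp
      exact (e.2.2.2 p hp).1.choose.elim0
    simpa using Fintype.card_congr (Equiv.ofBijective e.1 ⟨e.1.injective, hs⟩)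
  classical
  refine PiTensorProduct.ext (MultilinearMap.ext fun a => PiTensorProduct.ext
    (MultilinearMap.ext fun b => ?_))
  simp only [LinearMap.compMultilinearMap_apply]
  rw [completeShuffle_tprod, Fintype.sum_empty]
  rfl

/-- Interchanging the two words preserves the extended shuffles. -/
theorem IsExtendedShuffle.swap {e : Fin m ⊕ Fin n ↪ Fin r} (he : IsExtendedShuffle e) :
    IsExtendedShuffle ((Equiv.sumComm (Fin n) (Fin m)).toEmbedding.trans e) := by
  refine ⟨he.2.1, he.1, fun p hp => (he.2.2 p fun ⟨x, hx⟩ => hp ⟨x.swap, ?_⟩).symm⟩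
  simp [hx]

theorem completeShuffle_comm (l : A) (x : ⨂[k]^m A) (y : ⨂[k]^n A) :
    completeShuffle k l m n r x y = completeShuffle k l n m r y x := by
  classical
  suffices h : completeShuffle k l m n r = (completeShuffle k l n m r).flip by
    rw [h, LinearMap.flip_apply]
  refine PiTensorProduct.ext (MultilinearMap.ext fun a => PiTensorProduct.ext
    (MultilinearMap.ext fun b => ?_))
  simp only [LinearMap.compMultilinearMap_apply, LinearMap.flip_apply]
  rw [completeShuffle_tprod, completeShuffle_tprod]
  let φ : {e : Fin m ⊕ Fin n ↪ Fin r // IsExtendedShuffle e} ≃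
      {e : Fin n ⊕ Fin m ↪ Fin r // IsExtendedShuffle e} :=
    { toFun e := ⟨_, e.2.swap⟩
      invFun e := ⟨_, e.2.swap⟩
      left_inv e := Subtype.ext (DFunLike.ext _ _ fun x => by simp)
      right_inv e := Subtype.ext (DFunLike.ext _ _ fun x => by simp) }
  refine Fintype.sum_equiv φ _ _ fun e => congrArg _ (funext fun p => ?_)
  by_cases hp : ∃ x, e.1 x = p
  · obtain ⟨x, rfl⟩ := hp
    have hx : e.1 x = (φ e).1 x.swap := by simp [φ]
    rw [e.1.injective.extend_apply, hx, (φ e).1.injective.extend_apply]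
    cases x <;> rfl
  · rw [Function.extend_apply' _ _ _ hp, Function.extend_apply']
    rintro ⟨x, hx⟩
    exact hp ⟨x.swap, by simpa [φ] using hx⟩

end Shuffle

/-! ### Series with separated heads -/

/-- The tensor-power series, with the head split off in each coordinate, so that `A` acts on the
heads. The parameter `l` is the weight of the product. -/
def Series (k : Type u) {A : Type v} [Field k] [CommRing A] [Algebra k A] (_l : A) :
    Type (max u v) :=
  ∀ n : ℕ, A ⊗[k] (⨂[k]^n A)

namespace Series

variable {k : Type u} {A : Type v} [Field k] [CommRing A] [Algebra k A] {l : A}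

noncomputable instance instAddCommGroup : AddCommGroup (Series k l) :=
  inferInstanceAs (AddCommGroup (∀ n : ℕ, A ⊗[k] (⨂[k]^n A)))

noncomputable instance : Module A (Series k l) :=
  inferInstanceAs (Module A (∀ n : ℕ, A ⊗[k] (⨂[k]^n A)))

noncomputable instance : Module k (Series k l) :=
  inferInstanceAs (Module k (∀ n : ℕ, A ⊗[k] (⨂[k]^n A)))

instance : IsScalarTower k A (Series k l) :=
  inferInstanceAs (IsScalarTower k A (∀ n : ℕ, A ⊗[k] (⨂[k]^n A)))

/-- The coordinate whose tail has length `n`. -/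
noncomputable def coeff (n : ℕ) : Series k l →ₗ[A] A ⊗[k] (⨂[k]^n A) :=
  LinearMap.proj (R := A) (φ := fun n : ℕ => A ⊗[k] (⨂[k]^n A)) n

/-- The homogeneous series with a given coordinate. -/
noncomputable def single (n : ℕ) : A ⊗[k] (⨂[k]^n A) →ₗ[A] Series k l :=
  LinearMap.single A (fun n : ℕ => A ⊗[k] (⨂[k]^n A)) n

/-- The series with given coordinates. -/
def mk (c : ∀ n : ℕ, A ⊗[k] (⨂[k]^n A)) : Series k l := c

@[simp] theorem coeff_mk (c : ∀ n : ℕ, A ⊗[k] (⨂[k]^n A)) (n : ℕ) :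
    coeff n (mk c : Series k l) = c n := rfl

@[ext] theorem ext {x y : Series k l} (h : ∀ n, coeff n x = coeff n y) : x = y := funext h

@[simp] theorem coeff_single_same (n : ℕ) (t : A ⊗[k] (⨂[k]^n A)) :
    coeff n (single n t : Series k l) = t :=
  Pi.single_eq_same (M := fun n : ℕ => A ⊗[k] (⨂[k]^n A)) n t

theorem coeff_single_of_ne {m n : ℕ} (h : m ≠ n) (t : A ⊗[k] (⨂[k]^n A)) :
    coeff m (single n t : Series k l) = 0 :=
  Pi.single_eq_of_ne (M := fun n : ℕ => A ⊗[k] (⨂[k]^n A)) h t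

/-- The series whose terms have tails of length at least `n`. -/
noncomputable def fil (k : Type u) {A : Type v} [Field k] [CommRing A] [Algebra k A] (l : A)
    (n : ℕ) : Submodule A (Series k l) where
  carrier := {x | ∀ i < n, coeff i x = 0}
  add_mem' hx hy i hi := by rw [map_add, hx i hi, hy i hi, add_zero]
  zero_mem' i _ := map_zero _
  smul_mem' a x hx i hi := by rw [map_smul, hx i hi, smul_zero]

theorem mem_fil {n : ℕ} {x : Series k l} : x ∈ fil k l n ↔ ∀ i < n, coeff i x = 0 := Iff.rfl

theorem fil_antitone : Antitone (fil k l) := fun _ _ h _ hx i hi => hx i (hi.trans_le h)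

theorem single_mem_fil {m n : ℕ} (h : m ≤ n) (t : A ⊗[k] (⨂[k]^n A)) :
    (single n t : Series k l) ∈ fil k l m :=
  fun _ hi => coeff_single_of_ne (hi.trans_le h).ne t

theorem sub_sum_single_mem_fil (x : Series k l) (n : ℕ) :
    x - ∑ i ∈ Finset.range n, single i (coeff i x) ∈ fil k l n := by
  intro i hi
  rw [map_sub, map_sum, Finset.sum_eq_single i, coeff_single_same, sub_self]
  · exact fun j _ hj => coeff_single_of_ne hj.symm _
  · exact fun h => (h (Finset.mem_range.2 hi)).elim

/-- The Reynolds operator: the old head becomes the first letter of the tail. -/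
noncomputable def P : Series k l →ₗ[k] Series k l where
  toFun x := mk fun
    | 0 => 0
    | n + 1 => 1 ⊗ₜ consEquiv k n (coeff n x)
  map_add' x y := by
    ext n
    cases n <;> simp [TensorProduct.tmul_add]
  map_smul' t x := by
    ext n
    cases n <;> simp

@[simp] theorem coeff_zero_P (x : Series k l) : coeff 0 (P x) = 0 := rfl

@[simp] theorem coeff_succ_P (x : Series k l) (n : ℕ) :
    coeff (n + 1) (P x) = 1 ⊗ₜ consEquiv k n (coeff n x) := rfl

theorem P_mem_fil {n : ℕ} {x : Series k l} (hx : x ∈ fil k l n) : P x ∈ fil k l (n + 1) := by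
  rintro (_ | i) hi
  · rfl
  · rw [coeff_succ_P, hx i (by omega), map_zero, TensorProduct.tmul_zero]

theorem smul_P_single (n : ℕ) (a : A) (z : A ⊗[k] (⨂[k]^n A)) :
    a • P (single n z : Series k l) = single (n + 1) (a ⊗ₜ consEquiv k n z) := by
  ext m
  rcases m with _ | m
  · rw [map_smul, coeff_zero_P, smul_zero, coeff_single_of_ne (by omega)]
  · rw [map_smul, coeff_succ_P]
    by_cases h : m = n
    · subst h
      rw [coeff_single_same, coeff_single_same, TensorProduct.smul_tmul', smul_eq_mul, mul_one]
    · rw [coeff_single_of_ne h, coeff_single_of_ne (by omega), map_zero, TensorProduct.tmul_zero,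
        smul_zero]

/-- Homogeneous series with a nonempty tail are `A`-combinations of values of `P`. -/
theorem single_succ_mem_span (n : ℕ) (t : A ⊗[k] (⨂[k]^(n + 1) A)) :
    (single (n + 1) t : Series k l) ∈ Submodule.span A (P '' (fil k l n : Set (Series k l))) := by
  induction t with
  | zero => simp
  | add s t hs ht => rw [map_add]; exact add_mem hs ht
  | tmul a v =>
    obtain ⟨z, rfl⟩ := (consEquiv k n).surjective v
    rw [← smul_P_single]
    exact Submodule.smul_mem _ _ (Submodule.subset_span ⟨_, single_mem_fil le_rfl z, rfl⟩)

/-- The unit series, with the empty word as its tail. -/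
noncomputable def one : Series k l := single 0 (1 ⊗ₜ PiTensorProduct.tprod k Fin.elim0)

theorem exists_single_zero_eq (t : A ⊗[k] (⨂[k]^0 A)) :
    ∃ a : A, t = a ⊗ₜ PiTensorProduct.tprod k Fin.elim0 := by
  induction t with
  | zero => exact ⟨0, by simp⟩
  | add s t hs ht =>
    obtain ⟨a, rfl⟩ := hs
    obtain ⟨b, rfl⟩ := ht
    exact ⟨a + b, (TensorProduct.add_tmul _ _ _).symm⟩
  | tmul a v =>
    have h := (PiTensorProduct.isEmptyEquiv (R := k) (s := fun _ : Fin 0 => A)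
      (Fin 0)).symm_apply_apply v
    rw [PiTensorProduct.isEmptyEquiv_symm_apply] at h
    refine ⟨PiTensorProduct.isEmptyEquiv (R := k) (s := fun _ : Fin 0 => A) (Fin 0) v • a, ?_⟩
    rw [TensorProduct.smul_tmul]
    conv_lhs => rw [← h]
    congr 3

/-- Density principle: a closed `A`-submodule that contains `1` and the values of `P` is
everything. Here the submodule is the preimage of `Q` under the `A`-linear map `g`, and it is
closed because it is open. -/
theorem mem_of_isLinearMap {M : Type*} [AddCommGroup M] [Module A M] (Q : Submodule A M)
    {g : Series k l → M} (hg : IsLinearMap A g) (h1 : g one ∈ Q) (hP : ∀ x, g (P x) ∈ Q) (N : ℕ)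
    (hN : ∀ x ∈ fil k l N, g x ∈ Q) (x : Series k l) : g x ∈ Q := by
  change x ∈ Q.comap (hg.mk' g)
  rw [← sub_add_cancel x (∑ i ∈ Finset.range N, single i (coeff i x))]
  refine add_mem (hN _ (sub_sum_single_mem_fil x N)) (sum_mem fun i _ => ?_)
  rcases i with _ | i
  · obtain ⟨a, ha⟩ := exists_single_zero_eq (coeff 0 x)
    have : (single 0 (coeff 0 x) : Series k l) = a • one := by
      rw [ha, one, ← map_smul, TensorProduct.smul_tmul', smul_eq_mul, mul_one]
    rw [this]
    exact Submodule.smul_mem _ _ h1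
  · refine (Submodule.span_le.2 ?_) (single_succ_mem_span i (coeff (i + 1) x))
    rintro _ ⟨y, -, rfl⟩
    exact hP y

/-! ### The product -/

/-- The component `(a ⊗ 𝔞, b ⊗ 𝔟) ↦ ab ⊗ (𝔞 ⧢ 𝔟)_r` of the product, as an `A`-bilinear map. -/
noncomputable def homMul (k : Type u) {A : Type v} [Field k] [CommRing A] [Algebra k A] (l : A)
    (m n r : ℕ) :
    A ⊗[k] (⨂[k]^m A) →ₗ[A] A ⊗[k] (⨂[k]^n A) →ₗ[A] A ⊗[k] (⨂[k]^r A) :=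
  LinearMap.mk₂ A
    (fun x y => TensorProduct.map₂ (LinearMap.mul k A) (completeShuffle k l m n r) x y)
    (fun x x' y => by rw [map_add, LinearMap.add_apply])
    (fun a x y => by
      induction x with
      | zero => simp
      | add x x' hx hx' => rw [smul_add, map_add, LinearMap.add_apply, hx, hx', map_add,
          LinearMap.add_apply, smul_add]
      | tmul b v =>
        induction y with
        | zero => simp
        | add y y' hy hy' => rw [map_add, hy, hy', map_add, smul_add]
        | tmul c w => simp [TensorProduct.smul_tmul', mul_assoc])
    (fun x y y' => map_add _ _ _)
    (fun a x y => by
      induction x with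
      | zero => simp
      | add x x' hx hx' => rw [map_add, LinearMap.add_apply, hx, hx', LinearMap.add_apply,
          smul_add]
      | tmul b v =>
        induction y with
        | zero => simp
        | add y y' hy hy' => rw [smul_add, map_add, hy, hy', map_add, smul_add]
        | tmul c w => simp [TensorProduct.smul_tmul', mul_left_comm])

@[simp] theorem homMul_tmul (m n r : ℕ) (a b : A) (x : ⨂[k]^m A) (y : ⨂[k]^n A) :
    homMul k l m n r (a ⊗ₜ x) (b ⊗ₜ y) = (a * b) ⊗ₜ completeShuffle k l m n r x y := rfl

theorem homMul_eq_zero {m n r : ℕ} (h : r < m ∨ r < n) : homMul k l m n r = 0 := by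
  refine LinearMap.ext fun x => LinearMap.ext fun y => ?_
  change TensorProduct.map₂ (LinearMap.mul k A) (completeShuffle k l m n r) x y = 0
  rw [completeShuffle_eq_zero k l h]
  induction x with
  | zero => simp
  | add x x' hx hx' => rw [map_add, LinearMap.add_apply, hx, hx', add_zero]
  | tmul b v =>
    induction y with
    | zero => simp
    | add y y' hy hy' => rw [map_add, hy, hy', add_zero]
    | tmul c w => simp

theorem homMul_comm (m n r : ℕ) (x : A ⊗[k] (⨂[k]^m A)) (y : A ⊗[k] (⨂[k]^n A)) :
    homMul k l m n r x y = homMul k l n m r y x := by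
  induction x with
  | zero => simp
  | add x x' hx hx' => rw [map_add, LinearMap.add_apply, hx, hx', map_add]
  | tmul b v =>
    induction y with
    | zero => simp
    | add y y' hy hy' => rw [map_add, hy, hy', map_add, LinearMap.add_apply]
    | tmul c w => rw [homMul_tmul, homMul_tmul, mul_comm, completeShuffle_comm]

theorem homMul_one_left (n : ℕ) (y : A ⊗[k] (⨂[k]^n A)) :
    homMul k l 0 n n (1 ⊗ₜ PiTensorProduct.tprod k Fin.elim0) y = y := by
  induction y with
  | zero => simp
  | add y y' hy hy' => rw [map_add, hy, hy']
  | tmul c w => rw [homMul_tmul, completeShuffle_zero_left, one_mul]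

theorem homMul_one_left_of_ne {n r : ℕ} (h : n ≠ r) (y : A ⊗[k] (⨂[k]^n A)) :
    homMul k l 0 n r (1 ⊗ₜ PiTensorProduct.tprod k Fin.elim0) y = 0 := by
  induction y with
  | zero => simp
  | add y y' hy hy' => rw [map_add, hy, hy', add_zero]
  | tmul c w =>
    rw [homMul_tmul, completeShuffle_zero_left_of_ne k l h]
    exact TensorProduct.tmul_zero _ _

/-- The recursion of the complete shuffle product, as the homogeneous form of the Reynolds
identity. -/
theorem homMul_succ (m n r : ℕ) (x : A ⊗[k] (⨂[k]^m A)) (y : A ⊗[k] (⨂[k]^n A)) :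
    homMul k l (m + 1) (n + 1) (r + 1) (1 ⊗ₜ consEquiv k m x) (1 ⊗ₜ consEquiv k n y) =
      1 ⊗ₜ consEquiv k r
        (homMul k l (m + 1) n r (1 ⊗ₜ consEquiv k m x) y +
          homMul k l m (n + 1) r x (1 ⊗ₜ consEquiv k n y) -
          l • homMul k l (m + 1) (n + 1) r (1 ⊗ₜ consEquiv k m x) (1 ⊗ₜ consEquiv k n y)) := by
  rw [homMul_tmul, one_mul]
  congr 1
  induction x with
  | zero => simp
  | add x x' hx hx' =>
    simp only [map_add, TensorProduct.tmul_add, LinearMap.add_apply, smul_add, hx, hx', map_sub]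
    abel
  | tmul a v =>
    induction y with
    | zero => simp
    | add y y' hy hy' =>
      simp only [map_add, TensorProduct.tmul_add, smul_add, hy, hy', map_sub]
      abel
    | tmul b w =>
      simp only [homMul_tmul, completeShuffle_succ, one_mul, mul_one, TensorProduct.smul_tmul',
        smul_eq_mul, map_add, map_sub]
      abel

/-- The product of series, as an `A`-bilinear map. -/
noncomputable def mulHom : Series k l →ₗ[A] Series k l →ₗ[A] Series k l :=
  LinearMap.mk₂ A
    (fun x y => mk fun r => ∑ m ∈ Finset.range (r + 1), ∑ n ∈ Finset.range (r + 1),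
      homMul k l m n r (coeff m x) (coeff n y))
    (fun x x' y => by ext r; simp [Finset.sum_add_distrib])
    (fun a x y => by ext r; simp [Finset.smul_sum])
    (fun x y y' => by ext r; simp [Finset.sum_add_distrib])
    (fun a x y => by ext r; simp [Finset.smul_sum])

theorem coeff_mulHom (r : ℕ) (x y : Series k l) :
    coeff r (mulHom x y) = ∑ m ∈ Finset.range (r + 1), ∑ n ∈ Finset.range (r + 1),
      homMul k l m n r (coeff m x) (coeff n y) := rfl

/-- The ranges of summation in the product can be enlarged. -/
theorem coeff_mulHom_of_lt {r M N : ℕ} (hM : r < M) (hN : r < N) (x y : Series k l) :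
    coeff r (mulHom x y) = ∑ m ∈ Finset.range M, ∑ n ∈ Finset.range N,
      homMul k l m n r (coeff m x) (coeff n y) := by
  rw [coeff_mulHom, Finset.sum_subset (Finset.range_mono hM)]
  · refine Finset.sum_congr rfl fun m _ => Finset.sum_subset (Finset.range_mono hN) ?_
    intro n _ hn
    rw [homMul_eq_zero (Or.inr (by simpa using hn)), LinearMap.zero_apply, LinearMap.zero_apply]
  · intro m _ hm
    refine Finset.sum_eq_zero fun n _ => ?_
    rw [homMul_eq_zero (Or.inl (by simpa using hm)), LinearMap.zero_apply, LinearMap.zero_apply]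

theorem mulHom_comm (x y : Series k l) : mulHom x y = mulHom y x := by
  ext r
  rw [coeff_mulHom, coeff_mulHom, Finset.sum_comm]
  exact Finset.sum_congr rfl fun n _ => Finset.sum_congr rfl fun m _ => homMul_comm _ _ _ _ _

theorem one_mulHom (y : Series k l) : mulHom one y = y := by
  ext r
  rw [coeff_mulHom, Finset.sum_eq_single 0, Finset.sum_eq_single r]
  · rw [one, coeff_single_same, homMul_one_left]
  · intro n _ hn
    rw [one, coeff_single_same, homMul_one_left_of_ne hn]
  · exact fun h => (h (by simp)).elim
  · intro m _ hm
    refine Finset.sum_eq_zero fun n _ => ?_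
    rw [one, coeff_single_of_ne hm, map_zero, LinearMap.zero_apply]
  · exact fun h => (h (by simp)).elim

theorem mulHom_one (y : Series k l) : mulHom y one = y := by rw [mulHom_comm, one_mulHom]

theorem mulHom_mem_fil_left {n : ℕ} {x : Series k l} (hx : x ∈ fil k l n) (y : Series k l) :
    mulHom x y ∈ fil k l n := by
  intro r hr
  rw [coeff_mulHom]
  refine Finset.sum_eq_zero fun i hi => Finset.sum_eq_zero fun j _ => ?_
  rw [hx i (by simp at hi; omega), map_zero, LinearMap.zero_apply]

theorem mulHom_mem_fil_right {n : ℕ} {y : Series k l} (hy : y ∈ fil k l n) (x : Series k l) :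
    mulHom x y ∈ fil k l n := by
  rw [mulHom_comm]
  exact mulHom_mem_fil_left hy x

theorem mulHom_P_P (x y : Series k l) :
    mulHom (P x) (P y) =
      P (mulHom (P x) y + mulHom x (P y) - l • mulHom (P x) (P y)) := by
  ext r
  rcases r with _ | r
  · rw [coeff_zero_P, coeff_mulHom]
    simp
  · rw [coeff_succ_P, map_sub, map_add, map_smul, coeff_mulHom,
      coeff_mulHom_of_lt (r := r) (M := r + 2) (N := r + 1) (by omega) (by omega),
      coeff_mulHom_of_lt (r := r) (M := r + 1) (N := r + 2) (by omega) (by omega),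
      coeff_mulHom_of_lt (r := r) (M := r + 2) (N := r + 2) (by omega) (by omega)]
    simp only [Finset.sum_range_succ' _ (r + 1), coeff_zero_P, map_zero, LinearMap.zero_apply,
      Finset.sum_const_zero, add_zero, coeff_succ_P, homMul_succ]
    simp only [← map_sum, ← TensorProduct.tmul_sum, Finset.sum_add_distrib,
      Finset.sum_sub_distrib, Finset.smul_sum]

/-- The associator of three series. -/
noncomputable def assocDefect (x y z : Series k l) : Series k l :=
  mulHom (mulHom x y) z - mulHom x (mulHom y z)

/-- The Reynolds identity expresses the associator on values of `P` through `P` of associators. -/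
theorem assocDefect_P_P_P (x y z : Series k l) : assocDefect (P x) (P y) (P z) =
    P (assocDefect (P x) (P y) z + assocDefect (P x) y (P z) + assocDefect x (P y) (P z)
      - l • assocDefect (P x) (P y) (P z) - l • assocDefect (P x) (P y) (P z)) := by
  have h1 : mulHom (mulHom (P x) (P y)) (P z) =
      P (mulHom (mulHom (P x) (P y)) z + (mulHom (mulHom (P x) y) (P z) +
        mulHom (mulHom x (P y)) (P z) - l • mulHom (mulHom (P x) (P y)) (P z)) -
        l • mulHom (mulHom (P x) (P y)) (P z)) := by
    conv_lhs => rw [mulHom_P_P x y, mulHom_P_P, ← mulHom_P_P x y]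
    simp only [map_add, map_sub, map_smul, LinearMap.add_apply, LinearMap.sub_apply,
      LinearMap.smul_apply]
  have h2 : mulHom (P x) (mulHom (P y) (P z)) =
      P ((mulHom (P x) (mulHom (P y) z) + mulHom (P x) (mulHom y (P z)) -
        l • mulHom (P x) (mulHom (P y) (P z))) + mulHom x (mulHom (P y) (P z)) -
        l • mulHom (P x) (mulHom (P y) (P z))) := by
    conv_lhs => rw [mulHom_P_P y z, mulHom_P_P, ← mulHom_P_P y z]
    simp only [map_add, map_sub, map_smul]
  simp only [assocDefect]
  conv_lhs => rw [h1, h2]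
  rw [← map_sub]
  congr 1
  simp only [smul_sub]
  abel

theorem assocDefect_mem_fil (n : ℕ) : ∀ x y z : Series k l, assocDefect x y z ∈ fil k l n := by
  induction n with
  | zero => exact fun x y z i hi => (Nat.not_lt_zero _ hi).elim
  | succ n ih =>
    have hPPP (x y z : Series k l) : assocDefect (P x) (P y) (P z) ∈ fil k l (n + 1) := by
      rw [assocDefect_P_P_P]
      exact P_mem_fil (sub_mem (sub_mem (add_mem (add_mem (ih _ _ _) (ih _ _ _)) (ih _ _ _))
        (Submodule.smul_mem _ _ (ih _ _ _))) (Submodule.smul_mem _ _ (ih _ _ _)))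
    -- the associator is `A`-trilinear, so the density principle applies in each variable
    have hPP (x y z : Series k l) : assocDefect (P x) (P y) z ∈ fil k l (n + 1) := by
      refine mem_of_isLinearMap _ ⟨fun z z' => ?_, fun a z => ?_⟩ ?_ (hPPP x y) (n + 1)
        (fun z hz => ?_) z
      · simp only [assocDefect, map_add]
        abel
      · simp only [assocDefect, map_smul, smul_sub]
      · simp only [assocDefect, mulHom_one, sub_self, zero_mem]
      · exact sub_mem (mulHom_mem_fil_right hz _)
          (mulHom_mem_fil_right (mulHom_mem_fil_right hz _) _)
    have hP (x y z : Series k l) : assocDefect (P x) y z ∈ fil k l (n + 1) := by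
      refine mem_of_isLinearMap (g := fun y => assocDefect (P x) y z) _
        ⟨fun y y' => ?_, fun a y => ?_⟩ ?_ (fun y => hPP x y z) (n + 1) (fun y hy => ?_) y
      · simp only [assocDefect, map_add, LinearMap.add_apply]
        abel
      · simp only [assocDefect, map_smul, LinearMap.smul_apply, smul_sub]
      · simp only [assocDefect, mulHom_one, one_mulHom, sub_self, zero_mem]
      · exact sub_mem (mulHom_mem_fil_left (mulHom_mem_fil_right hy _) _)
          (mulHom_mem_fil_right (mulHom_mem_fil_left hy _) _)
    intro x y z
    refine mem_of_isLinearMap (g := fun x => assocDefect x y z) _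
      ⟨fun x x' => ?_, fun a x => ?_⟩ ?_ (fun x => hP x y z) (n + 1) (fun x hx => ?_) x
    · simp only [assocDefect, map_add, LinearMap.add_apply]
      abel
    · simp only [assocDefect, map_smul, LinearMap.smul_apply, smul_sub]
    · simp only [assocDefect, one_mulHom, sub_self, zero_mem]
    · exact sub_mem (mulHom_mem_fil_left (mulHom_mem_fil_left hx _) _)
        (mulHom_mem_fil_left hx _)

theorem eq_of_forall_sub_mem_fil {x y : Series k l} (h : ∀ n, x - y ∈ fil k l n) : x = y :=
  sub_eq_zero.1 (ext fun n => (h (n + 1) n (Nat.lt_succ_self n)).trans (map_zero _).symm)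

theorem mulHom_assoc (x y z : Series k l) :
    mulHom (mulHom x y) z = mulHom x (mulHom y z) :=
  eq_of_forall_sub_mem_fil fun n => assocDefect_mem_fil n x y z

noncomputable instance : CommRing (Series k l) where
  __ := instAddCommGroup
  mul x y := mulHom x y
  one := one
  left_distrib x y z := map_add (mulHom x) y z
  right_distrib x y z := by
    change mulHom (x + y) z = _
    rw [map_add]
    rfl
  zero_mul x := by
    change mulHom 0 x = 0
    rw [map_zero, LinearMap.zero_apply]
  mul_zero x := map_zero (mulHom x)
  mul_assoc := mulHom_assoc
  one_mul := one_mulHom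
  mul_one := mulHom_one
  mul_comm := mulHom_comm

theorem mul_def (x y : Series k l) : x * y = mulHom x y := rfl

theorem one_def : (1 : Series k l) = one := rfl

noncomputable instance : Algebra A (Series k l) :=
  Algebra.ofModule (fun a x y => by rw [mul_def, map_smul, LinearMap.smul_apply]; rfl)
    (fun a x y => by rw [mul_def, map_smul]; rfl)

noncomputable instance : Algebra k (Series k l) :=
  Algebra.ofModule
    (fun t x y => by rw [← algebraMap_smul A t x, ← algebraMap_smul A t (x * y), smul_mul_assoc])
    (fun t x y => by rw [← algebraMap_smul A t y, ← algebraMap_smul A t (x * y), mul_smul_comm])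

end Series

/-! ### Filtration topologies -/

section Topology

variable {A : Type u} {R : Type v} [CommRing A] [AddCommGroup R] [Module A R]
  {fil : ℕ → Submodule A R} (hfil : Antitone fil)

theorem mem_closure_filtrationTopology {S : Set R} {x : R} :
    x ∈ @closure R (filtrationTopology fil hfil) S ↔ ∀ n, ∃ s ∈ S, s - x ∈ fil n := by
  let := filtrationTopology fil hfil
  rw [mem_closure_iff]
  constructor
  · intro h n
    obtain ⟨s, hs, hsS⟩ := h {y | y - x ∈ fil n}
      (fun y hy => ⟨n, fun z hz => by simpa using add_mem hz hy⟩) (by simp)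
    exact ⟨s, hsS, hs⟩
  · intro h o ho hx
    obtain ⟨n, hn⟩ := ho x hx
    obtain ⟨s, hs, hsx⟩ := h n
    exact ⟨s, hn s hsx, hs⟩

theorem continuous_filtrationTopology_iff (φ : R →+ R) :
    Continuous[filtrationTopology fil hfil, filtrationTopology fil hfil] φ ↔
      ∀ m, ∃ n, ∀ x ∈ fil n, φ x ∈ fil m := by
  let := filtrationTopology fil hfil
  rw [continuous_def]
  constructor
  · intro h m
    have hm : IsOpen ((fil m : Submodule A R) : Set R) :=
      fun y hy => ⟨m, fun z hz => by simpa using add_mem hz hy⟩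
    obtain ⟨n, hn⟩ := h _ hm 0 (by simp)
    exact ⟨n, fun x hx => hn x (by simpa using hx)⟩
  · intro h U hU x hx
    obtain ⟨m, hm⟩ := hU _ hx
    obtain ⟨n, hn⟩ := h m
    exact ⟨n, fun y hy => hm _ (by simpa using hn _ hy)⟩

end Topology

namespace Series

variable {k : Type u} {A : Type v} [Field k] [CommRing A] [Algebra k A] {l : A}

theorem isFiltrationComplete_fil : IsFiltrationComplete (fil k l) fil_antitone := by
  refine ⟨fun x _ m n h => rfl, fun x _ y _ h => ?_, fun s hs => ?_⟩
  · exact eq_of_forall_sub_mem_fil fun n => (Submodule.Quotient.eq _).1 (congrFun h n)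
  · choose t ht using fun n => Submodule.Quotient.mk_surjective (fil k l n) (s n)
    -- the coordinate of index `i` can be read off modulo the term of index `i + 1`
    refine ⟨mk fun i => coeff i (t (i + 1)), trivial, funext fun n => ?_⟩
    change Submodule.Quotient.mk _ = _
    rw [← ht n, Submodule.Quotient.eq]
    intro i hi
    have h := hs (i + 1) n hi
    rw [← ht n, ← ht (i + 1)] at h
    have h' := (Submodule.Quotient.eq _).1 h i (Nat.lt_succ_self i)
    rw [map_sub, sub_eq_zero] at h'
    rw [map_sub, coeff_mk, sub_eq_zero]
    exact h'.symm

theorem fil_eq_closedPowers (n : ℕ) :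
    (fil k l n : Set (Series k l)) = closedPowers (fil k l) fil_antitone P n := by
  induction n with
  | zero => exact Set.eq_univ_of_forall fun x i hi => (Nat.not_lt_zero _ hi).elim
  | succ n ih =>
    ext x
    rw [closedPowers, ← ih, mem_closure_filtrationTopology]
    constructor
    · refine fun hx N => ⟨∑ i ∈ Finset.range N, single i (coeff i x), sum_mem fun i _ => ?_, ?_⟩
      · by_cases hi : i < n + 1
        · rw [hx i hi, map_zero]
          exact zero_mem _
        · obtain ⟨j, rfl⟩ := Nat.exists_eq_succ_of_ne_zero (n := i) (by omega)
          exact Submodule.span_mono (Set.image_mono (fil_antitone (by omega)))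
            (single_succ_mem_span j _)
      · rw [← neg_sub]
        exact neg_mem (sub_sum_single_mem_fil x N)
    · intro h
      obtain ⟨s, hs, hsx⟩ := h (n + 1)
      have hspan : Submodule.span A (P '' (fil k l n : Set (Series k l))) ≤ fil k l (n + 1) := by
        rw [Submodule.span_le]
        rintro _ ⟨y, hy, rfl⟩
        exact P_mem_fil hy
      have := sub_mem (hspan hs) hsx
      rwa [sub_sub_cancel] at this

/-! ### The modified differential operator -/

/-- Multiplying the first letter of the tail into the head. -/
noncomputable def merge (n : ℕ) : A ⊗[k] (⨂[k]^(n + 1) A) →ₗ[A] A ⊗[k] (⨂[k]^n A) :=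
  LinearMap.liftBaseChange A (consEquiv k n).symm.toLinearMap

@[simp] theorem merge_tmul (n : ℕ) (a : A) (v : ⨂[k]^(n + 1) A) :
    merge n (a ⊗ₜ[k] v) = a • (consEquiv k n).symm v := by
  simp [merge]

/-- The modified differential operator of weight `d 1` extending `d`. -/
noncomputable def D (d : A →ₗ[k] A) : Series k (d 1) →ₗ[k] Series k (d 1) where
  toFun x := mk fun
    | 0 => TensorProduct.map d LinearMap.id (coeff 0 x) + merge 0 (coeff 1 x)
    | n + 1 => TensorProduct.map d LinearMap.id (coeff (n + 1) x) + merge (n + 1) (coeff (n + 2) x)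
        - d 1 • coeff (n + 1) x
  map_add' x y := by
    ext n
    cases n <;> simp <;> abel
  map_smul' t x := by
    ext n
    cases n <;> simp [smul_sub, smul_comm t (d 1)]

variable {d : A →ₗ[k] A}

theorem coeff_zero_D (x : Series k (d 1)) :
    coeff 0 (D d x) = TensorProduct.map d LinearMap.id (coeff 0 x) + merge 0 (coeff 1 x) := rfl

theorem coeff_succ_D (x : Series k (d 1)) (n : ℕ) :
    coeff (n + 1) (D d x) = TensorProduct.map d LinearMap.id (coeff (n + 1) x) +
      merge (n + 1) (coeff (n + 2) x) - d 1 • coeff (n + 1) x := rfl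

theorem D_mem_fil {n : ℕ} {x : Series k (d 1)} (hx : x ∈ fil k (d 1) (n + 1)) :
    D d x ∈ fil k (d 1) n := by
  rintro (_ | i) hi
  · rw [coeff_zero_D, hx 0 (by omega), hx 1 (by omega)]
    simp
  · rw [coeff_succ_D, hx (i + 1) (by omega), hx (i + 2) (by omega)]
    simp

theorem D_P (x : Series k (d 1)) : D d (P x) = x := by
  ext n
  rcases n with _ | n
  · simp [coeff_zero_D]
  · simp [coeff_succ_D, TensorProduct.smul_tmul']

theorem D_one : D d one = d 1 • one := by
  ext n
  rcases n with _ | n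
  · rw [coeff_zero_D, map_smul, one, coeff_single_same, coeff_single_of_ne (by omega)]
    simp [TensorProduct.smul_tmul']
  · rw [coeff_succ_D, map_smul, one, coeff_single_of_ne (by omega),
      coeff_single_of_ne (by omega)]
    simp

theorem map_smul_head (hd : IsModifiedDifferential d) {V : Type*} [AddCommGroup V] [Module k V]
    (a : A) (t : A ⊗[k] V) :
    TensorProduct.map d LinearMap.id (a • t) =
      d a • t + a • TensorProduct.map d LinearMap.id t - (a * d 1) • t := by
  induction t with
  | zero => simp
  | add s t hs ht =>
    rw [smul_add, map_add, hs, ht]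
    simp only [smul_add, map_add]
    abel
  | tmul b v =>
    simp only [TensorProduct.smul_tmul', TensorProduct.map_tmul, smul_eq_mul, hd a b,
      TensorProduct.add_tmul, TensorProduct.sub_tmul, LinearMap.id_apply]

theorem D_smul (hd : IsModifiedDifferential d) (a : A) (x : Series k (d 1)) :
    D d (a • x) = d a • x + a • D d x - (a * d 1) • x := by
  ext n
  rcases n with _ | n
  · simp only [coeff_zero_D, map_add, map_sub, map_smul, map_smul_head hd, smul_add]
    abel
  · simp only [coeff_succ_D, map_add, map_sub, map_smul, map_smul_head hd, smul_add, smul_sub,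
      smul_smul, mul_comm a (d 1)]
    abel

/-- The defect of the modified Leibniz rule. -/
noncomputable def leibnizDefect (x y : Series k (d 1)) : Series k (d 1) :=
  D d (x * y) - D d x * y - x * D d y + d 1 • (x * y)

theorem P_mul_P (x y : Series k l) : P x * P y = P (P x * y + x * P y - l • (P x * P y)) :=
  mulHom_P_P x y

theorem leibnizDefect_P_P (x y : Series k (d 1)) : leibnizDefect (P x) (P y) = 0 := by
  rw [leibnizDefect, P_mul_P, D_P, D_P, D_P, ← P_mul_P]
  abel

theorem leibnizDefect_eq_zero (hd : IsModifiedDifferential d) (x y : Series k (d 1)) :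
    leibnizDefect x y = 0 := by
  refine eq_of_forall_sub_mem_fil fun n => ?_
  rw [sub_zero]
  have hP (x y : Series k (d 1)) : leibnizDefect (P x) y ∈ fil k (d 1) n := by
    refine mem_of_isLinearMap _ ⟨fun y y' => ?_, fun a y => ?_⟩ ?_
      (fun y => leibnizDefect_P_P x y ▸ zero_mem _) (n + 1) (fun y hy => ?_) y
    · simp only [leibnizDefect, mul_add, map_add, smul_add]
      abel
    · simp only [leibnizDefect, mul_smul_comm, D_smul hd, smul_add, smul_sub, mul_add, mul_sub,
        smul_smul, mul_comm (d 1) a]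
      abel
    · rw [leibnizDefect, D_one, ← one_def, mul_smul_comm, mul_one, mul_one]
      simp
    · have h := fil_antitone (k := k) (l := d 1) (Nat.le_succ n) hy
      exact add_mem (sub_mem (sub_mem (D_mem_fil (mulHom_mem_fil_right hy _))
        (mulHom_mem_fil_right h _)) (mulHom_mem_fil_right (D_mem_fil hy) _))
        (Submodule.smul_mem _ _ (mulHom_mem_fil_right h _))
  refine mem_of_isLinearMap (g := fun x => leibnizDefect x y) _
    ⟨fun x x' => ?_, fun a x => ?_⟩ ?_ (fun x => hP x y) (n + 1) (fun x hx => ?_) x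
  · simp only [leibnizDefect, add_mul, map_add, smul_add]
    abel
  · simp only [leibnizDefect, smul_mul_assoc, D_smul hd, smul_add, smul_sub, add_mul, sub_mul,
      smul_smul, mul_comm (d 1) a]
    abel
  · rw [leibnizDefect, D_one, ← one_def, smul_mul_assoc, one_mul, one_mul]
    simp
  · have h := fil_antitone (k := k) (l := d 1) (Nat.le_succ n) hx
    exact add_mem (sub_mem (sub_mem (D_mem_fil (mulHom_mem_fil_left hx _))
      (mulHom_mem_fil_left (D_mem_fil hx) _)) (mulHom_mem_fil_left h _))
      (Submodule.smul_mem _ _ (mulHom_mem_fil_left h _))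

theorem isModifiedDifferential_D (hd : IsModifiedDifferential d) :
    IsModifiedDifferential (D d) := by
  intro x y
  have h := leibnizDefect_eq_zero hd x y
  rw [leibnizDefect] at h
  rw [one_def, D_one, ← one_def, mul_smul_comm, mul_one, smul_mul_assoc]
  rw [← sub_eq_zero, ← h]
  abel

theorem isReynolds_P : IsReynolds (D d 1) (P : Series k (d 1) →ₗ[k] Series k (d 1)) := by
  intro x y
  rw [one_def, D_one, ← one_def, mul_smul_comm, mul_one, smul_mul_assoc, ← map_add, ← map_sub]
  exact P_mul_P x y

/-- The tensor-power series as a complete modified differential Reynolds algebra. -/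
noncomputable def completeMDRA (hd : IsModifiedDifferential d) :
    CompleteMDRA.{u, v, max u v} k d where
  carrier := Series k (d 1)
  fil := fil k (d 1)
  D := D d
  P := P
  D_modified := isModifiedDifferential_D hd
  D_algebraMap a := by
    have h (a : A) : algebraMap A (Series k (d 1)) a = a • one := Algebra.algebraMap_eq_smul_one a
    rw [h, h, D_smul hd, D_one, smul_smul, add_sub_cancel_right]
  P_reynolds := isReynolds_P
  D_P := D_P
  fil_antitone := fil_antitone
  complete := isFiltrationComplete_fil
  compatible := fil_eq_closedPowers
  continuous_mul_left x := (continuous_filtrationTopology_iff _ (AddMonoidHom.mulLeft x)).2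
    fun m => ⟨m, fun _ hy => mulHom_mem_fil_right hy x⟩
  continuous_D := (continuous_filtrationTopology_iff _ (D d).toAddMonoidHom).2
    fun m => ⟨m + 1, fun _ hx => D_mem_fil hx⟩

/-! ### Comparison with the tensor-power series -/

/-- Writing each head as the first letter of the word. -/
noncomputable def toSha : Series k l ≃ₗ[k] Sha k A :=
  LinearEquiv.piCongrRight (φ := fun n : ℕ => A ⊗[k] (⨂[k]^n A)) fun n => consEquiv k n

theorem toSha_apply (x : Series k l) (n : ℕ) : toSha x n = consEquiv k n (coeff n x) := rfl

theorem toSha_mul (x y : Series k l) : toSha (x * y) = Sha.mul k l (toSha x) (toSha y) := by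
  funext r
  simp only [toSha_apply, mul_def, coeff_mulHom, map_sum, Sha.mul, LinearEquiv.symm_apply_apply]
  rfl

theorem toSha_smul_one (a : A) : toSha (a • one : Series k l) = Sha.of k a := by
  funext n
  rw [toSha_apply, Sha.of, map_smul, one]
  rcases n with _ | n
  · rw [coeff_single_same, Pi.single_eq_same, TensorProduct.smul_tmul', consEquiv_tmul_tprod]
    congr 1
    funext i
    obtain rfl : i = 0 := Fin.fin_one_eq_zero i
    simp
  · rw [coeff_single_of_ne (by omega), smul_zero, map_zero, Pi.single_eq_of_ne (by omega)]

theorem mem_fil_iff_toSha (n : ℕ) (x : Series k l) : x ∈ fil k l n ↔ toSha x ∈ Sha.fil k n := by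
  simp only [Sha.fil, Set.mem_ofPred_eq, toSha_apply, EmbeddingLike.map_eq_zero_iff, mem_fil]

theorem toSha_P (x : Series k l) : toSha (P x) = Sha.P k (toSha x) := by
  funext n
  rcases n with _ | n
  · rw [toSha_apply, coeff_zero_P, map_zero]
    rfl
  · rfl

theorem onHead_consEquiv (g : A →ₗ[k] A) (n : ℕ) (t : A ⊗[k] (⨂[k]^n A)) :
    Sha.onHead k g n (consEquiv k n t) = consEquiv k n (TensorProduct.map g LinearMap.id t) := by
  simp [Sha.onHead]

theorem mergeHead_consEquiv (n : ℕ) (t : A ⊗[k] (⨂[k]^(n + 1) A)) :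
    Sha.mergeHead k n (consEquiv k (n + 1) t) = consEquiv k n (merge n t) := by
  induction t with
  | zero => simp
  | add s t hs ht => simp only [map_add, hs, ht]
  | tmul a v =>
    obtain ⟨z, rfl⟩ := (consEquiv k n).surjective v
    induction z with
    | zero => simp
    | add s t hs ht => simp only [map_add, TensorProduct.tmul_add, hs, ht]
    | tmul b w => simp [Sha.mergeHead, TensorProduct.smul_tmul']

theorem map_mulLeft (a : A) {V : Type*} [AddCommGroup V] [Module k V] (t : A ⊗[k] V) :
    TensorProduct.map (LinearMap.mulLeft k a) LinearMap.id t = a • t := by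
  induction t with
  | zero => simp
  | add s t hs ht => rw [map_add, hs, ht, smul_add]
  | tmul b v => rfl

theorem toSha_D (x : Series k (d 1)) : toSha (D d x) = Sha.D k d (toSha x) := by
  funext n
  rcases n with _ | n
  · simp only [Sha.D, toSha_apply, onHead_consEquiv, mergeHead_consEquiv, coeff_zero_D, map_add]
  · simp only [Sha.D, toSha_apply, onHead_consEquiv, mergeHead_consEquiv, coeff_succ_D, map_add,
      map_sub, map_mulLeft]

end Series

/-! ### The universal property -/

namespace CompleteMDRA

variable {k : Type u} {A : Type v} [Field k] [CommRing A] [Algebra k A] {d : A →ₗ[k] A}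
  (R : CompleteMDRA.{u, v, w} k d)

theorem mem_fil_zero (x : R.carrier) : x ∈ R.fil 0 := by
  rw [← SetLike.mem_coe, R.compatible 0]
  trivial

theorem P_mem_fil {n : ℕ} {x : R.carrier} (hx : x ∈ R.fil n) : R.P x ∈ R.fil (n + 1) := by
  have h : R.P x ∈ (R.fil (n + 1) : Set R.carrier) := by
    rw [R.compatible (n + 1), closedPowers, ← R.compatible n]
    exact (mem_closure_filtrationTopology R.fil_antitone).2
      fun m => ⟨R.P x, Submodule.subset_span ⟨x, hx, rfl⟩, by simp⟩
  exact h

theorem exists_mul_mem_fil (x : R.carrier) (m : ℕ) : ∃ n, ∀ y ∈ R.fil n, x * y ∈ R.fil m :=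
  (continuous_filtrationTopology_iff R.fil_antitone (AddMonoidHom.mulLeft x)).1
    (R.continuous_mul_left x) m

theorem exists_D_mem_fil (m : ℕ) : ∃ n, ∀ y ∈ R.fil n, R.D y ∈ R.fil m :=
  (continuous_filtrationTopology_iff R.fil_antitone R.D.toAddMonoidHom).1 R.continuous_D m

variable {R} in
theorem eq_of_forall_sub_mem_fil {x y : R.carrier} (h : ∀ n, x - y ∈ R.fil n) : x = y :=
  R.complete.2.1 trivial trivial (funext fun n => (Submodule.Quotient.eq _).2 (h n))

theorem exists_limit (s : ℕ → R.carrier) (hs : ∀ n, s (n + 1) - s n ∈ R.fil n) :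
    ∃ y, ∀ n, y - s n ∈ R.fil n := by
  have hle (m n : ℕ) (h : m ≤ n) : s n - s m ∈ R.fil m := by
    induction n, h using Nat.le_induction with
    | base => simp
    | succ n hmn ih =>
      have := add_mem (R.fil_antitone hmn (hs n)) ih
      rwa [sub_add_sub_cancel] at this
  obtain ⟨y, -, hy⟩ := R.complete.2.2
    (show (fun n => Submodule.Quotient.mk (s n)) ∈ inverseLimit R.fil R.fil_antitone from
      fun m n h => (Submodule.Quotient.eq _).2 (hle m n h))
  exact ⟨y, fun n => (Submodule.Quotient.eq _).1 (congrFun hy n)⟩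

theorem D_one : R.D 1 = algebraMap A R.carrier (d 1) := by
  rw [← R.D_algebraMap, map_one (algebraMap A R.carrier)]

theorem D_smul (a : A) (x : R.carrier) : R.D (a • x) = d a • x + a • R.D x - (a * d 1) • x := by
  rw [Algebra.smul_def, R.D_modified, R.D_algebraMap, D_one, ← map_mul, ← Algebra.smul_def,
    ← Algebra.smul_def, ← Algebra.smul_def]

theorem P_mul_P (x y : R.carrier) :
    R.P x * R.P y = R.P (R.P x * y + x * R.P y - d 1 • (R.P x * R.P y)) := by
  conv_lhs => rw [R.P_reynolds, D_one, ← map_add, ← map_sub]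
  rw [mul_right_comm, Algebra.smul_def, mul_comm (algebraMap A R.carrier (d 1))]

/-- The nested operator words `a₁ ⊗ ⋯ ⊗ aₙ ↦ P(a₁ P(a₂ ⋯ P(aₙ)))`. -/
noncomputable def tailEval : ∀ n : ℕ, (⨂[k]^n A) →ₗ[k] R.carrier
  | 0 => LinearMap.toSpanSingleton k R.carrier 1 ∘ₗ
      (PiTensorProduct.isEmptyEquiv (R := k) (s := fun _ : Fin 0 => A) (Fin 0)).toLinearMap
  | n + 1 => R.P ∘ₗ (LinearMap.liftBaseChange A (tailEval n)).restrictScalars k ∘ₗ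
      (consEquiv k n).symm.toLinearMap

/-- The map `a₀ ⊗ a₁ ⊗ ⋯ ⊗ aₙ ↦ a₀ P(a₁ P(a₂ ⋯ P(aₙ)))`. -/
noncomputable def homEval (n : ℕ) : A ⊗[k] (⨂[k]^n A) →ₗ[A] R.carrier :=
  LinearMap.liftBaseChange A (R.tailEval n)

theorem homEval_one : R.homEval 0 (1 ⊗ₜ PiTensorProduct.tprod k Fin.elim0) = 1 := by
  simp [homEval, tailEval]

theorem homEval_succ (n : ℕ) (t : A ⊗[k] (⨂[k]^n A)) :
    R.homEval (n + 1) (1 ⊗ₜ consEquiv k n t) = R.P (R.homEval n t) := by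
  simp [homEval, tailEval]

theorem homEval_mem_fil (n : ℕ) (t : A ⊗[k] (⨂[k]^n A)) : R.homEval n t ∈ R.fil n := by
  induction n with
  | zero => exact R.mem_fil_zero _
  | succ n ih =>
    induction t with
    | zero => simp
    | add s t hs ht => rw [map_add]; exact add_mem hs ht
    | tmul a v =>
      obtain ⟨z, rfl⟩ := (consEquiv k n).surjective v
      have : a ⊗ₜ[k] consEquiv k n z = a • (1 : A) ⊗ₜ[k] consEquiv k n z := by
        rw [TensorProduct.smul_tmul', smul_eq_mul, mul_one]
      rw [this, map_smul, homEval_succ]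
      exact Submodule.smul_mem _ _ (R.P_mem_fil (ih z))

/-- The value of a truncated series. -/
noncomputable def truncEval (n : ℕ) : Series k (d 1) →ₗ[A] R.carrier :=
  ∑ i ∈ Finset.range n, R.homEval i ∘ₗ Series.coeff i

theorem truncEval_apply (n : ℕ) (x : Series k (d 1)) :
    R.truncEval n x = ∑ i ∈ Finset.range n, R.homEval i (Series.coeff i x) := by
  simp [truncEval]

theorem exists_eval (x : Series k (d 1)) : ∃ y, ∀ n, y - R.truncEval n x ∈ R.fil n := by
  refine R.exists_limit _ fun n => ?_
  rw [truncEval_apply, truncEval_apply, Finset.sum_range_succ, add_sub_cancel_left]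
  exact R.homEval_mem_fil n _

/-- The value in `R` of a series: the limit of the values of its truncations. -/
noncomputable def eval : Series k (d 1) →ₗ[A] R.carrier where
  toFun x := (R.exists_eval x).choose
  map_add' x y := eq_of_forall_sub_mem_fil fun n => by
    have := sub_mem ((R.exists_eval (x + y)).choose_spec n)
      (add_mem ((R.exists_eval x).choose_spec n) ((R.exists_eval y).choose_spec n))
    rwa [map_add, sub_add_sub_comm, sub_sub_sub_cancel_right] at this
  map_smul' a x := eq_of_forall_sub_mem_fil fun n => by
    have := sub_mem ((R.exists_eval (a • x)).choose_spec n)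
      (Submodule.smul_mem _ a ((R.exists_eval x).choose_spec n))
    rwa [map_smul, smul_sub, sub_sub_sub_cancel_right] at this

theorem eval_sub_truncEval_mem (x : Series k (d 1)) (n : ℕ) :
    R.eval x - R.truncEval n x ∈ R.fil n := (R.exists_eval x).choose_spec n

theorem eval_eq {x : Series k (d 1)} {y : R.carrier}
    (h : ∀ n, y - R.truncEval n x ∈ R.fil n) : R.eval x = y :=
  eq_of_forall_sub_mem_fil fun n => by
    have := sub_mem (R.eval_sub_truncEval_mem x n) (h n)
    rwa [sub_sub_sub_cancel_right] at this

theorem eval_mem_fil {n : ℕ} {x : Series k (d 1)} (hx : x ∈ Series.fil k (d 1) n) :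
    R.eval x ∈ R.fil n := by
  have h := R.eval_sub_truncEval_mem x n
  rwa [truncEval_apply, Finset.sum_eq_zero, sub_zero] at h
  intro i hi
  rw [hx i (Finset.mem_range.1 hi), map_zero]

theorem eval_one : R.eval Series.one = 1 := by
  refine R.eval_eq fun n => ?_
  rcases n with _ | n
  · exact R.mem_fil_zero _
  · rw [truncEval_apply, Finset.sum_range_succ', Finset.sum_eq_zero, Series.one,
      Series.coeff_single_same, homEval_one, zero_add, sub_self]
    · exact zero_mem _
    · intro i _
      rw [Series.one, Series.coeff_single_of_ne (by omega), map_zero]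

theorem eval_P (x : Series k (d 1)) : R.eval (Series.P x) = R.P (R.eval x) := by
  refine R.eval_eq fun n => ?_
  rcases n with _ | n
  · exact R.mem_fil_zero _
  · have h : R.truncEval (n + 1) (Series.P x) = R.P (R.truncEval n x) := by
      rw [truncEval_apply, truncEval_apply, Finset.sum_range_succ', map_sum, Series.coeff_zero_P,
        map_zero, add_zero]
      exact Finset.sum_congr rfl fun i _ => R.homEval_succ i _
    rw [h, ← map_sub]
    exact R.P_mem_fil (R.eval_sub_truncEval_mem x n)

/-- The failure of the evaluation to be multiplicative. -/
noncomputable def mulDefect (x y : Series k (d 1)) : R.carrier :=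
  R.eval (x * y) - R.eval x * R.eval y

theorem mulDefect_P_P (x y : Series k (d 1)) : R.mulDefect (Series.P x) (Series.P y) =
    R.P (R.mulDefect (Series.P x) y + R.mulDefect x (Series.P y) -
      d 1 • R.mulDefect (Series.P x) (Series.P y)) := by
  simp only [mulDefect]
  conv_lhs => rw [Series.P_mul_P, eval_P, eval_P, eval_P, P_mul_P, ← map_sub]
  congr 1
  simp only [map_add, map_sub, map_smul, eval_P, smul_sub]
  abel

/-- The recursion for the defect on values of `P` pushes it arbitrarily deep into the
filtration. -/
theorem mulDefect_mem_fil (n : ℕ) : ∀ x y : Series k (d 1), R.mulDefect x y ∈ R.fil n := by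
  induction n with
  | zero => exact fun x y => R.mem_fil_zero _
  | succ n ih =>
    have hPP (x y : Series k (d 1)) : R.mulDefect (Series.P x) (Series.P y) ∈ R.fil (n + 1) := by
      rw [mulDefect_P_P]
      exact R.P_mem_fil (sub_mem (add_mem (ih _ _) (ih _ _)) (Submodule.smul_mem _ _ (ih _ _)))
    have hP (x y : Series k (d 1)) : R.mulDefect (Series.P x) y ∈ R.fil (n + 1) := by
      obtain ⟨N, hN⟩ := R.exists_mul_mem_fil (R.eval (Series.P x)) (n + 1)
      refine Series.mem_of_isLinearMap _ ⟨fun y y' => ?_, fun a y => ?_⟩ ?_ (hPP x)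
        (max N (n + 1)) (fun y hy => sub_mem ?_ ?_) y
      · simp only [mulDefect, mul_add, map_add]
        abel
      · simp only [mulDefect, mul_smul_comm, map_smul, smul_sub]
      · rw [mulDefect, eval_one, ← Series.one_def, mul_one, mul_one, sub_self]
        exact zero_mem _
      · exact R.eval_mem_fil (Series.mulHom_mem_fil_right
          (Series.fil_antitone (le_max_right _ _) hy) _)
      · exact hN _ (R.eval_mem_fil (Series.fil_antitone (le_max_left _ _) hy))
    intro x y
    obtain ⟨N, hN⟩ := R.exists_mul_mem_fil (R.eval y) (n + 1)
    refine Series.mem_of_isLinearMap (g := fun x => R.mulDefect x y) _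
      ⟨fun x x' => ?_, fun a x => ?_⟩ ?_ (fun x => hP x y)
      (max N (n + 1)) (fun x hx => sub_mem ?_ ?_) x
    · simp only [mulDefect, add_mul, map_add]
      abel
    · simp only [mulDefect, smul_mul_assoc, map_smul, smul_sub]
    · rw [mulDefect, eval_one, ← Series.one_def, one_mul, one_mul, sub_self]
      exact zero_mem _
    · exact R.eval_mem_fil (Series.mulHom_mem_fil_left
        (Series.fil_antitone (le_max_right _ _) hx) _)
    · rw [mul_comm]
      exact hN _ (R.eval_mem_fil (Series.fil_antitone (le_max_left _ _) hx))

theorem eval_mul (x y : Series k (d 1)) : R.eval (x * y) = R.eval x * R.eval y :=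
  eq_of_forall_sub_mem_fil fun n => R.mulDefect_mem_fil n x y

theorem eval_D (hd : IsModifiedDifferential d) (x : Series k (d 1)) :
    R.eval (Series.D d x) = R.D (R.eval x) := by
  refine eq_of_forall_sub_mem_fil fun n => ?_
  obtain ⟨N, hN⟩ := R.exists_D_mem_fil n
  refine Series.mem_of_isLinearMap (g := fun x => R.eval (Series.D d x) - R.D (R.eval x)) _
    ⟨fun x x' => ?_, fun a x => ?_⟩ ?_ (fun x => ?_)
    (max N (n + 1)) (fun x hx => sub_mem ?_ ?_) x
  · simp only [map_add]
    abel
  · simp only [map_add, map_sub, map_smul, Series.D_smul hd, D_smul, smul_sub]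
    abel
  · rw [Series.D_one, map_smul, eval_one, D_one, Algebra.smul_def, mul_one, sub_self]
    exact zero_mem _
  · rw [Series.D_P, eval_P, R.D_P, sub_self]
    exact zero_mem _
  · exact R.eval_mem_fil (Series.D_mem_fil (Series.fil_antitone (le_max_right _ _) hx))
  · exact hN _ (R.eval_mem_fil (Series.fil_antitone (le_max_left _ _) hx))

/-- The evaluation of series as a homomorphism of `A`-algebras. -/
noncomputable def evalHom : Series k (d 1) →ₐ[A] R.carrier :=
  AlgHom.ofLinearMap R.eval R.eval_one R.eval_mul

theorem isHom_evalHom (hd : IsModifiedDifferential d) :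
    (Series.completeMDRA hd).IsHom R R.evalHom where
  map_D := R.eval_D hd
  map_P := R.eval_P
  map_fil _ _ hx := R.eval_mem_fil hx

/-- Two homomorphisms agree modulo every term of the filtration, since their difference commutes
with `P`, which raises the filtration degree. -/
theorem IsHom.unique {hd : IsModifiedDifferential d}
    {f g : (Series.completeMDRA hd).carrier →ₐ[A] R.carrier}
    (hf : (Series.completeMDRA hd).IsHom R f) (hg : (Series.completeMDRA hd).IsHom R g) :
    f = g := by
  have h (n : ℕ) : ∀ x : Series k (d 1), f.toLinearMap x - g.toLinearMap x ∈ R.fil n := by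
    induction n with
    | zero => exact fun x => R.mem_fil_zero _
    | succ n ih =>
      refine Series.mem_of_isLinearMap _ (f.toLinearMap - g.toLinearMap).isLinear ?_
        (fun x => ?_) (n + 1) (fun x hx => sub_mem (hf.map_fil _ x hx) (hg.map_fil _ x hx))
      · have h1 : f.toLinearMap (1 : (Series.completeMDRA hd).carrier) - g.toLinearMap 1 = 0 := by
          simp
        exact h1 ▸ zero_mem _
      · have h2 : f.toLinearMap (Series.P x) - g.toLinearMap (Series.P x) =
            R.P (f.toLinearMap x - g.toLinearMap x) := by
          rw [map_sub]
          exact congrArg₂ _ (hf.map_P x) (hg.map_P x)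
        exact h2 ▸ R.P_mem_fil (ih x)
  exact AlgHom.ext fun x => eq_of_forall_sub_mem_fil fun n => h n x

end CompleteMDRA
end FreeReynolds

theorem mainTheorem1 (k : Type u) (A : Type v) [Field k] [CharZero k] [CommRing A]
    [Algebra k A] (d : A →ₗ[k] A) (hd : FreeReynolds.IsModifiedDifferential d) :
    ∃ (F : FreeReynolds.CompleteMDRA.{u, v, max u v} k d)
      (e : F.carrier ≃ₗ[k] FreeReynolds.Sha k A),
      (∀ x y, e (x * y) = FreeReynolds.Sha.mul k (d 1) (e x) (e y)) ∧
      (∀ a, e (algebraMap A F.carrier a) = FreeReynolds.Sha.of k a) ∧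
      (∀ n x, x ∈ F.fil n ↔ e x ∈ FreeReynolds.Sha.fil k n) ∧
      (∀ x, e (F.P x) = FreeReynolds.Sha.P k (e x)) ∧
      (∀ x, e (F.D x) = FreeReynolds.Sha.D k d (e x)) ∧
      ∀ R : FreeReynolds.CompleteMDRA.{u, v, w} k d,
        ∃! f : F.carrier →ₐ[A] R.carrier, F.IsHom R f :=
  ⟨FreeReynolds.Series.completeMDRA hd, FreeReynolds.Series.toSha,
    FreeReynolds.Series.toSha_mul, FreeReynolds.Series.toSha_smul_one,
    FreeReynolds.Series.mem_fil_iff_toSha, FreeReynolds.Series.toSha_P,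
    FreeReynolds.Series.toSha_D, fun R => ⟨R.evalHom, R.isHom_evalHom hd,
      fun _ hf => FreeReynolds.CompleteMDRA.IsHom.unique R hf (R.isHom_evalHom hd)⟩⟩
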